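/- A dessin is a 2-cell embedding of a connected bipartite graph with at least one edge into a closed oriented surface. Equivalently, it is a finite non-empty set $E$ (the edges) with two permutations $\rho,\lambda$ of $E$ generating a transitive group; the black vertices, white vertices and faces are the cycles of $\rho$, $\lambda$ and $\rho\lambda$. Its automorphism group $\mathrm{Aut}(D)$ is the centralizer of $\{\rho,\lambda\}$ in $\mathrm{Sym}(E)$, and $D$ is regular if $\mathrm{Aut}(D)$ is transitive on $E$. The automorphisms of the free group $F_2=\langle X,Y\rangle$ act on isomorphism classes of dessins through the representation $X\mapsto\rho$, $Y\mapsto\lambda$ (an automorphism $\sigma$ replaces an edge stabilizer $N\le F_2$ by $\sigma(N)$); a totally symmetric dessin is a regular dessin that is invariant, up to isomorphism, under all of them. The type of a regular dessin is the triple of orders of $(\rho,\lambda,\rho\lambda)$, and its genus $g$ is given by $2-2g=\#\text{vertices}-\#\text{edges}+\#\text{faces}$. Write $[g,h]=g^{-1}h^{-1}gh$. For a prime $p$ and integers $a,b,c\ge 1$ let $\mathcal R(p;a,b,c)$ be the following set of relations in two generators $x,y$, where $z:=[x,y]$, $u:=[z,x]$, $v:=[z,y]$: $$x^{p^a}=y^{p^a}=z^{p^b}=u^{p^c}=v^{p^c}=[x,u]=[x,v]=[y,u]=[y,v]=1.$$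 Let $G=\langle x,y\rangle$ be one of the following groups: (i) $p>3$ prime, $1\le c\le b\le a$, relations $\mathcal R(p;a,b,c)$; (ii) $p=3$, $1\le c<b=a$ or $1\le c\le b\le a-1$, relations $\mathcal R(3;a,b,c)$; (iii) $p=2$, $1\le c\le b\le a-1$, relations $\mathcal R(2;a,b,c)$; (iv) $p=2$, $1\le c\le b\le a-2$, relations $\mathcal R(2;a,b,c)$ and $x^{2^{a-1}}=u^{2^{c-1}}$, $y^{2^{a-1}}=v^{2^{c-1}}$; (v) $p=2$, $1\le c\le a-2$, relations $\mathcal R(2;a,a-1,c)$ and $x^{2^{a-1}}=z^{2^{a-2}}$, $y^{2^{a-1}}=z^{2^{a-2}}$; (vi) $p=2$, $1\le c\le a-2$, relations $\mathcal R(2;a,a-1,c)$ and $x^{2^{a-1}}=z^{2^{a-2}}u^{2^{c-1}}$, $y^{2^{a-1}}=z^{2^{a-2}}v^{2^{c-1}}$. Then there is a totally symmetric dessin $D$ with $\mathrm{Aut}(D)\cong G$; up to isomorphism it is the only regular dessin with automorphism group isomorphic to $G$; and $|G|$, $|\mathrm{Aut}(G)|$, the type and the genus of $D$ are $$\begin{array}{l|llll}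 & |G| & |\mathrm{Aut}(G)| & \text{type of } D & \text{genus of } D\\ \hline \text{(i)} & p^{2(a+c)+b} & p^{4a+2b+4c-3}(p+1)(p-1)^2 & (p^a,p^a,p^a) & p^{a+b+2c}(p^a-3)/2+1\\ \text{(ii)} & 3^{2(a+c)+b} & 2^4\cdot 3^{4a+2b+4c-3} & (3^a,3^a,3^a) & 3^{a+b+2c+1}(3^{a-1}-1)/2+1\\ \text{(iii)} & 2^{2(a+c)+b} & 3\cdot 2^{4a+2b+4c-3} & (2^a,2^a,2^a) & 2^{a+b+2c-1}(2^a-3)+1\\ \text{(iv)} & 2^{2(a+c)+b-2} & 3\cdot 2^{4a+2b+4c-7} & (2^a,2^a,2^a) & 2^{a+b+2c-3}(2^a-3)+1\\ \text{(v)} & 2^{3a+2c-3} & 3\cdot 2^{6a+4c-9} & (2^a,2^a,2^a) & 2^{2a+2c-4}(2^a-3)+1\\ \text{(vi)} & 2^{3a+2c-3} & 3\cdot 2^{6a+4c-9} & (2^a,2^a,2^a) & 2^{2a+2c-4}(2^a-3)+1 \end{array}$$ -/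

import Mathlib

/-! ## Dessins -/

/-- A dessin, given by its monodromy: a finite non-empty set of edges with the permutation `black`
(resp. `white`) which cyclically permutes the edges around each black (resp. white) vertex along the
global orientation; connectedness of the underlying graph is transitivity of the group that the two
permutations generate, i.e. of the induced action of the free group `F₂ = ⟨X, Y⟩`. -/
structure Dessin where
  Edge : Type
  [finite : Finite Edge]
  [nonempty : Nonempty Edge]
  black : Equiv.Perm Edge
  white : Equiv.Perm Edge
  transitive : ∀ e f : Edge, ∃ w : FreeGroup (Fin 2), FreeGroup.lift ![black, white] w e = f

namespace Dessin

/-- The permutation representation `F₂ → Mon(D)`, `X ↦ black`, `Y ↦ white`. -/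
def monodromy (D : Dessin) : FreeGroup (Fin 2) →* Equiv.Perm D.Edge :=
  FreeGroup.lift ![D.black, D.white]

/-- Two dessins are isomorphic if some bijection of the edges carries the two permutations of the
first dessin to those of the second. -/
def Isomorphic (D D' : Dessin) : Prop :=
  ∃ φ : D.Edge ≃ D'.Edge, ∀ e, φ (D.black e) = D'.black (φ e) ∧ φ (D.white e) = D'.white (φ e)

/-- The automorphism group of a dessin: the permutations of the edges which commute with the
monodromy. -/
def autGroup (D : Dessin) : Subgroup (Equiv.Perm D.Edge) :=
  Subgroup.centralizer {D.black, D.white}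

/-- A dessin is regular if its automorphism group is transitive on the edges. -/
def IsRegular (D : Dessin) : Prop :=
  ∀ e f : D.Edge, ∃ α ∈ D.autGroup, α e = f

theorem lift_op (D : Dessin) (σ : MulAut (FreeGroup (Fin 2))) :
    FreeGroup.lift ![D.monodromy (σ⁻¹ (FreeGroup.of 0)), D.monodromy (σ⁻¹ (FreeGroup.of 1))] =
      D.monodromy.comp (σ⁻¹ : MulAut (FreeGroup (Fin 2))).toMonoidHom := by
  apply FreeGroup.ext_hom
  intro i
  fin_cases i <;> simp

/-- The dessin `D^σ` for an automorphism `σ` of `F₂`: if `N` is the stabilizer in `F₂` of an edge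
of `D`, then `σ(N)` is the stabilizer of the same edge of `D^σ`. -/
def op (D : Dessin) (σ : MulAut (FreeGroup (Fin 2))) : Dessin where
  Edge := D.Edge
  finite := D.finite
  nonempty := D.nonempty
  black := D.monodromy (σ⁻¹ (FreeGroup.of 0))
  white := D.monodromy (σ⁻¹ (FreeGroup.of 1))
  transitive e f := by
    obtain ⟨w, hw⟩ := D.transitive e f
    refine ⟨σ w, ?_⟩
    rw [lift_op]
    simpa [monodromy] using hw

/-- A dessin is totally symmetric if it is regular and invariant under all dessin operations. -/
def IsTotallySymmetric (D : Dessin) : Prop :=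
  D.IsRegular ∧ ∀ σ : MulAut (FreeGroup (Fin 2)), (D.op σ).Isomorphic D

/-- The type `(l, m, n)`; in a regular dessin these are the common lengths of the cycles around
the black vertices, the white vertices and the faces. -/
noncomputable def type (D : Dessin) : ℕ × ℕ × ℕ :=
  (orderOf D.black, orderOf D.white, orderOf (D.black * D.white))

/-- The number of orbits of the cyclic group generated by a permutation (fixed points included). -/
noncomputable def numCycles {E : Type} (π : Equiv.Perm E) : ℕ :=
  Nat.card (Quotient (Equiv.Perm.SameCycle.setoid π))

/-- Vertices minus edges plus faces; black vertices, white vertices and faces are the cycles of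
`black`, `white` and `black * white`. -/
noncomputable def eulerChar (D : Dessin) : ℤ :=
  (numCycles D.black + numCycles D.white : ℤ) - Nat.card D.Edge + numCycles (D.black * D.white)

/-- The supporting closed orientable surface has genus `g`. -/
def HasGenus (D : Dessin) (g : ℕ) : Prop :=
  D.eulerChar = 2 - 2 * (g : ℤ)

end Dessin

/-! ## The groups -/

namespace DessinGroup

/-- The commutator in the convention `[x, y] = x⁻¹ y⁻¹ x y`. -/
def comm {G : Type*} [Group G] (x y : G) : G := x⁻¹ * y⁻¹ * x * y

def X : FreeGroup (Fin 2) := FreeGroup.of 0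
def Y : FreeGroup (Fin 2) := FreeGroup.of 1
def Z : FreeGroup (Fin 2) := comm X Y
def U : FreeGroup (Fin 2) := comm Z X
def V : FreeGroup (Fin 2) := comm Z Y

/-- The relators common to all families. -/
def baseRels (p a b c : ℕ) : Set (FreeGroup (Fin 2)) :=
  {X ^ p ^ a, Y ^ p ^ a, Z ^ p ^ b, U ^ p ^ c, V ^ p ^ c, comm X U, comm X V, comm Y U, comm Y V}

/-- Families (i), (ii), (iii). -/
abbrev G₁ (p a b c : ℕ) : Type := PresentedGroup (baseRels p a b c)

/-- Family (iv): additionally `x^(2^(a-1)) = u^(2^(c-1))`, `y^(2^(a-1)) = v^(2^(c-1))`. -/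
abbrev G₄ (a b c : ℕ) : Type :=
  PresentedGroup (baseRels 2 a b c ∪
    {X ^ 2 ^ (a - 1) * (U ^ 2 ^ (c - 1))⁻¹, Y ^ 2 ^ (a - 1) * (V ^ 2 ^ (c - 1))⁻¹})

/-- Family (v): `b = a - 1`, additionally `x^(2^(a-1)) = z^(2^(a-2))`,
`y^(2^(a-1)) = z^(2^(a-2))`. -/
abbrev G₅ (a c : ℕ) : Type :=
  PresentedGroup (baseRels 2 a (a - 1) c ∪
    {X ^ 2 ^ (a - 1) * (Z ^ 2 ^ (a - 2))⁻¹, Y ^ 2 ^ (a - 1) * (Z ^ 2 ^ (a - 2))⁻¹})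

/-- Family (vi): `b = a - 1`, additionally `x^(2^(a-1)) = z^(2^(a-2)) u^(2^(c-1))`,
`y^(2^(a-1)) = z^(2^(a-2)) v^(2^(c-1))`. -/
abbrev G₆ (a c : ℕ) : Type :=
  PresentedGroup (baseRels 2 a (a - 1) c ∪
    {X ^ 2 ^ (a - 1) * (Z ^ 2 ^ (a - 2) * U ^ 2 ^ (c - 1))⁻¹,
     Y ^ 2 ^ (a - 1) * (Z ^ 2 ^ (a - 2) * V ^ 2 ^ (c - 1))⁻¹})

/-- One row of the table: `|G|`, `|Aut(G)|`, and the type and the genus of the totally symmetric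
dessin `D` with `Aut(D) ≅ G`, which is, up to isomorphism, the only regular dessin with this
automorphism group. -/
def Row (G : Type) [Group G] (order autOrder : ℕ) (type : ℕ × ℕ × ℕ) (genus : ℚ) : Prop :=
  Nat.card G = order ∧ Nat.card (MulAut G) = autOrder ∧
    ∃ D : Dessin, D.IsTotallySymmetric ∧ Nonempty (D.autGroup ≃* G) ∧
      (∀ D' : Dessin, D'.IsRegular → Nonempty (D'.autGroup ≃* G) → D'.Isomorphic D) ∧
      D.type = type ∧ ∃ g : ℕ, D.HasGenus g ∧ (g : ℚ) = genus

end DessinGroup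

/-!
A regular dessin whose automorphism group is isomorphic to a finite group `G` is the same thing as a
generating pair `(g, h)` of `G` (`Dessin.isomorphic_cayley_of_isRegular`), and automorphisms of `G`
give isomorphisms of dessins. If `Aut G` is transitive on the generating pairs, then there is exactly
one such dessin, it is invariant under `Aut F₂`, the order of `Aut G` is the number of generating
pairs, and all members of generating pairs have the same order, which gives type and genus
(`DessinGroup.row_of_transitive`).

The groups of all six families are treated at once. The free nilpotent group of class 3 on `x`, `y`
is realized on `ℤ⁵` by collecting the basic commutators (`FreeNil`), with a closed formula for powers
(`FreeNil.pow_eq`). For suitable `n`, `B`, `C`, `β`, `γ` the relations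
`z ^ B = u ^ C = v ^ C = 1`, `x ^ n = z ^ β * u ^ γ`, `y ^ n = z ^ β * v ^ γ` define a congruence on
it whose quotient has order `n ^ 2 * B * C ^ 2` (`Data.card_quo`) and the presentation of the family
(`Data.nonempty_presentedGroup_mulEquiv`). The first three families have `n = p ^ a` and
`β = γ = 0`; the others have `p = 2`, `n = 2 ^ (a - 1)`, and `β` or `γ` (or both) half of `B` or `C`.

A pair generates the quotient if and only if the determinant of its exponents of `x`, `y` is prime to
`p`: otherwise a linear functional modulo `p` vanishes on the pair, and conversely Burnside's basis
theorem applies (`Data.closure_eq_top_of_not_dvd_det`). For such a pair the power formula shows that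
the defining relations hold (`Data.relations_of_det`); the hypotheses on `a`, `b`, `c` are what makes
the binomial coefficients `n.choose 2` and `n.choose 3` disappear, or, in the last two families,
makes `n.choose 2` contribute the right involution. Hence `Aut G` is transitive on generating pairs,
whose number is `|GL₂(p)|` times the square of the order of the Frattini subgroup.
-/

/-! ### Regular dessins and generating pairs -/

namespace Dessin

theorem lift_mulLeft {G : Type} [Group G] (x y : G) :
    FreeGroup.lift ![Equiv.mulLeft x, Equiv.mulLeft y] =
      (MulAction.toPermHom G G).comp (FreeGroup.lift ![x, y]) := by
  apply FreeGroup.ext_hom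
  intro i
  fin_cases i <;> (ext; simp)

theorem range_lift_pair {G : Type*} [Group G] (x y : G) :
    (FreeGroup.lift ![x, y]).range = Subgroup.closure {x, y} := by
  rw [FreeGroup.range_lift_eq_closure]
  simp [Matrix.range_cons, Set.pair_comm]

/-- The regular dessin of a finite group `G` generated by `x` and `y`: the edges are the elements
of `G`, and the monodromy acts by left multiplication. Its automorphisms are then the right
multiplications. -/
def cayley (G : Type) [Group G] [Finite G] (x y : G) (hxy : Subgroup.closure {x, y} = ⊤) :
    Dessin where
  Edge := G
  black := Equiv.mulLeft x
  white := Equiv.mulLeft y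
  transitive e f := by
    have hmem : f * e⁻¹ ∈ (FreeGroup.lift ![x, y]).range := by
      rw [range_lift_pair, hxy]
      exact Subgroup.mem_top _
    obtain ⟨w, hw⟩ := hmem
    refine ⟨w, ?_⟩
    rw [lift_mulLeft]
    simp [hw]

section Cayley

variable {G : Type} [Group G] [Finite G] {x y : G} (hxy : Subgroup.closure {x, y} = ⊤)

theorem cayley_monodromy (w : FreeGroup (Fin 2)) (e : G) :
    (cayley G x y hxy).monodromy w e = FreeGroup.lift ![x, y] w * e := by
  show FreeGroup.lift ![Equiv.mulLeft x, Equiv.mulLeft y] w e = _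
  rw [lift_mulLeft]
  rfl

theorem mulRight_mem_cayley_autGroup (g : G) :
    (Equiv.mulRight g : Equiv.Perm G) ∈ (cayley G x y hxy).autGroup := by
  show (Equiv.mulRight g : Equiv.Perm G) ∈
    Subgroup.centralizer ({Equiv.mulLeft x, Equiv.mulLeft y} : Set (Equiv.Perm G))
  rw [Subgroup.mem_centralizer_iff]
  rintro _ (rfl | rfl) <;> (ext e; exact (mul_assoc _ _ _).symm)

theorem cayley_isRegular : (cayley G x y hxy).IsRegular := fun e f =>
  ⟨_, mulRight_mem_cayley_autGroup hxy ((show G from e)⁻¹ * (show G from f)), by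
    exact mul_inv_cancel_left (show G from e) (show G from f)⟩

/-- A dessin automorphism is determined by the image of one edge. -/
theorem autGroup_ext (D : Dessin) {α β : Equiv.Perm D.Edge} (hα : α ∈ D.autGroup)
    (hβ : β ∈ D.autGroup) (e : D.Edge) (h : α e = β e) : α = β := by
  have key : ∀ γ ∈ D.autGroup, ∀ w : FreeGroup (Fin 2), ∀ f,
      γ (FreeGroup.lift ![D.black, D.white] w f) =
        FreeGroup.lift ![D.black, D.white] w (γ f) := by
    intro γ hγ w f
    have hw : FreeGroup.lift ![D.black, D.white] w ∈ Subgroup.centralizer {γ} := by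
      have : (FreeGroup.lift ![D.black, D.white]).range ≤ Subgroup.centralizer {γ} := by
        rw [FreeGroup.range_lift_eq_closure, Subgroup.closure_le]
        rintro _ ⟨i, rfl⟩
        rw [autGroup, Subgroup.mem_centralizer_iff] at hγ
        simp only [SetLike.mem_coe, Subgroup.mem_centralizer_singleton_iff]
        fin_cases i
        · exact hγ _ (by simp)
        · exact hγ _ (by simp)
      exact this ⟨w, rfl⟩
    rw [Subgroup.mem_centralizer_singleton_iff] at hw
    exact (DFunLike.congr_fun hw f).symm
  ext f
  obtain ⟨w, rfl⟩ := D.transitive e f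
  rw [key α hα, key β hβ, h]

/-- In a regular dessin the automorphism group is in bijection with the edges; `α` corresponds to
`α⁻¹ e`, so that the monodromy becomes left multiplication. -/
theorem isomorphic_cayley_of_isRegular (D : Dessin) (hD : D.IsRegular)
    (φ : D.autGroup ≃* G) :
    ∃ (g h : G) (hgh : Subgroup.closure {g, h} = ⊤), D.Isomorphic (cayley G g h hgh) := by
  obtain ⟨e⟩ := D.nonempty
  have hbij : Function.Bijective fun α : D.autGroup => (α⁻¹ : D.autGroup).1 e := by
    constructor
    · intro α β h
      exact inv_injective (Subtype.ext (D.autGroup_ext (α⁻¹).2 (β⁻¹).2 e h))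
    · intro f
      obtain ⟨α, hα, rfl⟩ := hD e f
      exact ⟨⟨α, hα⟩⁻¹, by simp⟩
  let F := Equiv.ofBijective _ hbij
  have hF : ∀ α : D.autGroup, F α = (α.1)⁻¹ e := fun α => rfl
  obtain ⟨β, hβ⟩ := F.surjective (D.black e)
  obtain ⟨ω, hω⟩ := F.surjective (D.white e)
  have comm_black : ∀ (α : D.autGroup) f, D.black ((α.1)⁻¹ f) = (α.1)⁻¹ (D.black f) := by
    intro α f
    have := (Subgroup.mem_centralizer_iff.mp (inv_mem α.2)) D.black (by simp)
    exact DFunLike.congr_fun this f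
  have comm_white : ∀ (α : D.autGroup) f, D.white ((α.1)⁻¹ f) = (α.1)⁻¹ (D.white f) := by
    intro α f
    have := (Subgroup.mem_centralizer_iff.mp (inv_mem α.2)) D.white (by simp)
    exact DFunLike.congr_fun this f
  have hb : ∀ α, D.black (F α) = F (β * α) := by
    intro α
    rw [hF, comm_black, ← hβ]
    simp [hF]
  have hw : ∀ α, D.white (F α) = F (ω * α) := by
    intro α
    rw [hF, comm_white, ← hω]
    simp [hF]
  have hmon : ∀ (w : FreeGroup (Fin 2)) α, FreeGroup.lift ![D.black, D.white] w (F α) =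
      F (FreeGroup.lift ![β, ω] w * α) := by
    have : FreeGroup.lift ![D.black, D.white] =
        (F.permCongrHom.toMonoidHom.comp (MulAction.toPermHom D.autGroup D.autGroup)).comp
          (FreeGroup.lift ![β, ω]) := by
      apply FreeGroup.ext_hom
      intro i
      ext f
      obtain ⟨α, rfl⟩ := F.surjective f
      fin_cases i
      · simp [hb, Equiv.permCongrHom]
      · simp [hw, Equiv.permCongrHom]
    intro w α
    rw [this]
    simp [Equiv.permCongrHom]
  have hgen : Subgroup.closure {β, ω} = ⊤ := by
    rw [eq_top_iff]
    intro α _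
    obtain ⟨w, hw⟩ := D.transitive (F 1) (F α)
    rw [hmon, mul_one] at hw
    rw [← range_lift_pair]
    exact ⟨w, F.injective hw⟩
  refine ⟨φ β, φ ω, ?_, F.symm.trans φ.toEquiv, ?_⟩
  · have := congrArg (Subgroup.map φ.toMonoidHom) hgen
    rw [MonoidHom.map_closure, Subgroup.map_top_of_surjective _ φ.surjective] at this
    simpa [Set.image_pair] using this
  · intro f
    obtain ⟨α, rfl⟩ := F.surjective f
    constructor
    · rw [hb]
      show φ (F.symm (F (β * α))) = φ β * φ (F.symm (F α))
      simp
    · rw [hw]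
      show φ (F.symm (F (ω * α))) = φ ω * φ (F.symm (F α))
      simp

/-- The automorphism group of `cayley G x y` consists of the right multiplications. -/
theorem nonempty_cayley_autGroup_mulEquiv : Nonempty ((cayley G x y hxy).autGroup ≃* G) := by
  let f : G →* (cayley G x y hxy).autGroup :=
    { toFun := fun g => ⟨(Equiv.mulRight g⁻¹ : Equiv.Perm G), mulRight_mem_cayley_autGroup hxy g⁻¹⟩
      map_one' := by
        apply Subtype.ext
        refine Equiv.ext fun e : G => ?_
        show e * 1⁻¹ = e
        simp
      map_mul' := fun g h => by
        apply Subtype.ext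
        refine Equiv.ext fun e : G => ?_
        show e * (g * h)⁻¹ = e * h⁻¹ * g⁻¹
        group }
  have hf : ∀ g (e : G), (f g).1 e = e * g⁻¹ := fun g e => rfl
  refine ⟨(MulEquiv.ofBijective f ⟨?_, ?_⟩).symm⟩
  · intro g h hgh
    have := congrArg (fun α => α.1 (1 : G)) hgh
    exact inv_injective (mul_left_cancel this)
  · intro α
    refine ⟨(show G from α.1 (1 : G))⁻¹, Subtype.ext (autGroup_ext _ (f _).2 α.2 (1 : G) ?_)⟩
    exact (one_mul (M := G) _).trans (inv_inv (G := G) _)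

theorem cayley_isomorphic_of_mulAut {g h : G} (hgh : Subgroup.closure {g, h} = ⊤) (φ : MulAut G)
    (h1 : φ x = g) (h2 : φ y = h) : (cayley G g h hgh).Isomorphic (cayley G x y hxy) := by
  subst h1 h2
  exact ⟨φ.symm.toEquiv, fun e : G =>
    ⟨by show φ.symm (φ x * e) = x * φ.symm e; simp, by show φ.symm (φ y * e) = y * φ.symm e; simp⟩⟩

theorem Isomorphic.trans {D₁ D₂ D₃ : Dessin} (h : D₁.Isomorphic D₂) (h' : D₂.Isomorphic D₃) :
    D₁.Isomorphic D₃ := by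
  obtain ⟨φ, hφ⟩ := h
  obtain ⟨ψ, hψ⟩ := h'
  exact ⟨φ.trans ψ, fun e => ⟨by simp [(hφ e).1, (hψ _).1], by simp [(hφ e).2, (hψ _).2]⟩⟩

/-- A dessin operation turns the dessin of a generating pair into that of another generating pair of
the same group. -/
theorem cayley_op_isomorphic (σ : MulAut (FreeGroup (Fin 2))) :
    ∃ (g h : G) (hgh : Subgroup.closure {g, h} = ⊤),
      ((cayley G x y hxy).op σ).Isomorphic (cayley G g h hgh) := by
  set L : FreeGroup (Fin 2) →* G := FreeGroup.lift ![x, y] with hL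
  have hgen : Subgroup.closure {L (σ⁻¹ (FreeGroup.of 0)), L (σ⁻¹ (FreeGroup.of 1))} = ⊤ := by
    have h1 : FreeGroup.lift ![L (σ⁻¹ (FreeGroup.of 0)), L (σ⁻¹ (FreeGroup.of 1))] =
        L.comp (σ⁻¹ : MulAut (FreeGroup (Fin 2))).toMonoidHom := by
      apply FreeGroup.ext_hom
      intro i
      fin_cases i <;> simp
    have h2 : L.range = ⊤ := by rw [range_lift_pair, hxy]
    have h3 := congrArg MonoidHom.range h1
    rwa [range_lift_pair, MonoidHom.range_comp,
      MonoidHom.range_eq_top.mpr (MulEquiv.surjective _), ← MonoidHom.range_eq_map, h2] at h3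
  refine ⟨_, _, hgen, Equiv.refl G, fun e : G => ⟨?_, ?_⟩⟩
  · exact cayley_monodromy hxy _ e
  · exact cayley_monodromy hxy _ e

end Cayley

/-- The cycles of a left multiplication are the right cosets of the cyclic group of the multiplier. -/
theorem numCycles_mulLeft_mul_orderOf {G : Type} [Group G] (g : G) :
    numCycles (Equiv.mulLeft g) * orderOf g = Nat.card G := by
  have h : (Equiv.Perm.SameCycle.setoid (Equiv.mulLeft g)) =
      QuotientGroup.rightRel (Subgroup.zpowers g) := by
    ext e f
    rw [QuotientGroup.rightRel_apply, Subgroup.mem_zpowers_iff]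
    show Equiv.Perm.SameCycle _ _ _ ↔ _
    refine exists_congr fun i => ?_
    rw [Equiv.zpow_mulLeft, Equiv.coe_mulLeft, eq_mul_inv_iff_mul_eq]
  rw [numCycles, h, ← Nat.card_zpowers, mul_comm, ← (Subgroup.zpowers g).card_mul_index,
    Subgroup.index, Nat.card_congr (QuotientGroup.quotientRightRelEquivQuotientLeftRel _)]

theorem orderOf_mulLeft {G : Type} [Group G] (g : G) : orderOf (Equiv.mulLeft g : Equiv.Perm G) = orderOf g := by
  have := orderOf_injective (MulAction.toPermHom G G) MulAction.toPerm_injective g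
  exact this

end Dessin

namespace DessinGroup

/-- If every generating pair of `G` is the image of `(x, y)` under an automorphism, then the
automorphisms of `G` are in bijection with the generating pairs. -/
theorem card_mulAut_eq_card_generating_pairs {G : Type} [Group G] {x y : G}
    (hxy : Subgroup.closure {x, y} = ⊤)
    (hom : ∀ g h : G, Subgroup.closure {g, h} = ⊤ → ∃ φ : MulAut G, φ x = g ∧ φ y = h) :
    Nat.card (MulAut G) = Nat.card {q : G × G // Subgroup.closure {q.1, q.2} = ⊤} := by
  refine Nat.card_congr (Equiv.ofBijective
    (fun φ : MulAut G => (⟨(φ x, φ y), ?_⟩ : {q : G × G // Subgroup.closure {q.1, q.2} = ⊤}))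
    ⟨?_, ?_⟩)
  · have := congrArg (Subgroup.map φ.toMonoidHom) hxy
    rw [MonoidHom.map_closure, Subgroup.map_top_of_surjective _ φ.surjective] at this
    simpa [Set.image_pair] using this
  · intro φ ψ h
    simp only [Subtype.mk.injEq, Prod.mk.injEq] at h
    have : φ.toMonoidHom = ψ.toMonoidHom := by
      refine MonoidHom.eq_of_eqOn_dense hxy ?_
      rintro _ (rfl | rfl)
      · exact h.1
      · exact h.2
    exact MulEquiv.ext fun g => DFunLike.congr_fun this g
  · rintro ⟨⟨g, h⟩, hgh⟩
    obtain ⟨φ, h1, h2⟩ := hom g h hgh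
    exact ⟨φ, by simp [h1, h2]⟩

/-- A group whose generating pairs form one orbit of its automorphism group has exactly one regular
dessin, which is totally symmetric; its type is `(l, l, l)`, where `l` is the order of an element
of a generating pair, because `(y, x)` and `(xy, x)` are generating pairs as well. -/
theorem row_of_transitive {G : Type} [Group G] [Finite G] {x y : G}
    (hxy : Subgroup.closure {x, y} = ⊤)
    (hom : ∀ g h : G, Subgroup.closure {g, h} = ⊤ → ∃ φ : MulAut G, φ x = g ∧ φ y = h)
    {p a d : ℕ} (hp : p.Prime) (had : a < d) (h3 : 3 ≤ p ^ a)
    (hcard : Nat.card G = p ^ d) (hx : orderOf x = p ^ a) {autOrder : ℕ}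
    (haut : Nat.card {q : G × G // Subgroup.closure {q.1, q.2} = ⊤} = autOrder) :
    Row G (p ^ d) autOrder (p ^ a, p ^ a, p ^ a)
      ((p : ℚ) ^ (d - a) * ((p : ℚ) ^ a - 3) / 2 + 1) := by
  have horder : ∀ g h : G, Subgroup.closure {g, h} = ⊤ → orderOf g = p ^ a := by
    intro g h hgh
    obtain ⟨φ, rfl, -⟩ := hom g h hgh
    rw [← hx]
    exact orderOf_injective φ.toMonoidHom φ.injective x
  have hy : orderOf y = p ^ a := horder y x (by rw [Set.pair_comm]; exact hxy)
  have hxy' : orderOf (x * y) = p ^ a := by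
    refine horder (x * y) x ?_
    rw [eq_top_iff, ← hxy, Subgroup.closure_le]
    have m1 : x ∈ Subgroup.closure {x * y, x} := Subgroup.subset_closure (by simp)
    have m2 : x * y ∈ Subgroup.closure {x * y, x} := Subgroup.subset_closure (by simp)
    rintro _ (rfl | rfl)
    · exact m1
    · have := mul_mem (inv_mem m1) m2
      rwa [inv_mul_cancel_left] at this
  have uniq : ∀ (g h : G) (hgh : Subgroup.closure {g, h} = ⊤),
      (Dessin.cayley G g h hgh).Isomorphic (Dessin.cayley G x y hxy) := by
    intro g h hgh
    obtain ⟨φ, h1, h2⟩ := hom g h hgh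
    exact Dessin.cayley_isomorphic_of_mulAut hxy hgh φ h1 h2
  have hmul : Equiv.mulLeft x * Equiv.mulLeft y = Equiv.mulLeft (x * y) := by
    ext; simp
  refine ⟨hcard, (card_mulAut_eq_card_generating_pairs hxy hom).trans haut,
    Dessin.cayley G x y hxy, ⟨Dessin.cayley_isRegular hxy, fun σ => ?_⟩,
    Dessin.nonempty_cayley_autGroup_mulEquiv hxy, ?_, ?_, ?_⟩
  · obtain ⟨g, h, hgh, i⟩ := Dessin.cayley_op_isomorphic hxy σ
    exact i.trans (uniq g h hgh)
  · rintro D' hD' ⟨φ⟩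
    obtain ⟨g, h, hgh, i⟩ := D'.isomorphic_cayley_of_isRegular hD' φ
    exact i.trans (uniq g h hgh)
  · show (orderOf (Equiv.mulLeft x), orderOf (Equiv.mulLeft y),
      orderOf (Equiv.mulLeft x * Equiv.mulLeft y)) = _
    rw [hmul, Dessin.orderOf_mulLeft, Dessin.orderOf_mulLeft, Dessin.orderOf_mulLeft, hx, hy, hxy']
  · -- Each of the three permutations has `p ^ (d - a)` cycles.
    have hcyc : ∀ g : G, orderOf g = p ^ a → Dessin.numCycles (Equiv.mulLeft g) = p ^ (d - a) := by
      intro g hg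
      have h := Dessin.numCycles_mulLeft_mul_orderOf g
      rw [hg, hcard, ← Nat.sub_add_cancel had.le, pow_add] at h
      exact Nat.eq_of_mul_eq_mul_right (pow_pos hp.pos a) h
    obtain ⟨r, hr⟩ : 2 ∣ p ^ (d - a) * (p ^ a - 3) := by
      rcases hp.eq_two_or_odd' with rfl | hodd
      · exact Dvd.dvd.mul_right (dvd_pow_self 2 (by omega)) _
      · obtain ⟨s, hs⟩ := hodd.pow (n := a)
        exact Dvd.dvd.mul_left ⟨s - 1, by omega⟩ _
    refine ⟨r + 1, ?_, ?_⟩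
    · have hr' : ((p : ℤ) ^ (d - a)) * ((p : ℤ) ^ a - 3) = 2 * r := by
        have := congrArg (Nat.cast : ℕ → ℤ) hr
        push_cast [Nat.cast_sub h3] at this
        exact this
      have hd : (p : ℤ) ^ d = (p : ℤ) ^ (d - a) * (p : ℤ) ^ a := by
        rw [← pow_add, Nat.sub_add_cancel had.le]
      show ((Dessin.numCycles (Equiv.mulLeft x) + Dessin.numCycles (Equiv.mulLeft y) : ℤ)
        - Nat.card G + Dessin.numCycles (Equiv.mulLeft x * Equiv.mulLeft y)) = _
      rw [hmul, hcyc _ hx, hcyc _ hy, hcyc _ hxy', hcard]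
      push_cast
      linear_combination -hd - hr'
    · have hr' : ((p : ℚ) ^ (d - a)) * ((p : ℚ) ^ a - 3) = 2 * r := by
        have := congrArg (Nat.cast : ℕ → ℚ) hr
        push_cast [Nat.cast_sub h3] at this
        exact this
      rw [hr']
      push_cast
      ring

theorem Row.of_mulEquiv {G G' : Type} [Group G] [Group G'] (e : G ≃* G') {order autOrder : ℕ}
    {type : ℕ × ℕ × ℕ} {genus : ℚ} (h : Row G' order autOrder type genus) :
    Row G order autOrder type genus := by
  obtain ⟨h1, h2, D, h3, ⟨φ⟩, h5, h6⟩ := h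
  exact ⟨(Nat.card_congr e.toEquiv).trans h1,
    (Nat.card_congr (MulAut.congr e).toEquiv).trans h2, D, h3, ⟨φ.trans e.symm⟩,
    fun D' hD' ⟨ψ⟩ => h5 D' hD' ⟨ψ.trans e⟩, h6⟩

/-! ### Triangular numbers -/

/-- The binomial coefficient `t (t - 1) / 2` of an integer. -/
def tri (t : ℤ) : ℤ := t * (t - 1) / 2

theorem two_mul_tri (t : ℤ) : 2 * tri t = t * (t - 1) := by
  have : Even (t * (t - 1)) := Int.even_mul_pred_self t
  exact Int.mul_ediv_cancel' this.two_dvd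

theorem tri_add (s t : ℤ) : tri (s + t) = tri s + tri t + s * t := by
  have h1 := two_mul_tri (s + t)
  have h2 := two_mul_tri s
  have h3 := two_mul_tri t
  linarith

@[simp] theorem tri_zero : tri 0 = 0 := rfl
@[simp] theorem tri_one : tri 1 = 0 := rfl

theorem tri_mul (s t : ℤ) : tri (s * t) = s ^ 2 * tri t + t * tri s := by
  have h1 := two_mul_tri (s * t)
  have h2 := two_mul_tri s
  have h3 := two_mul_tri t
  refine mul_left_cancel₀ two_ne_zero ?_
  linear_combination h1 - s ^ 2 * h3 - t * h2

/-! ### The free nilpotent group of class 3 on two generators -/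

/-- The free nilpotent group of class 3 on two generators `x`, `y`. The tuple `(i, j, k, l, m)`
stands for `x ^ i * y ^ j * z ^ k * u ^ l * v ^ m`, where `z = [x, y]`, and `u = [z, x]`,
`v = [z, y]` are central. -/
@[ext] structure FreeNil where
  i : ℤ
  j : ℤ
  k : ℤ
  l : ℤ
  m : ℤ

namespace FreeNil

/-- The product which collecting the powers of `x`, `y`, `z`, `u`, `v` from left to right produces,
by `z * x = x * z * u`, `z * y = y * z * v` and `y * x = x * y * z⁻¹`. -/
instance : Mul FreeNil where
  mul a b := ⟨a.i + b.i, a.j + b.j, a.k + b.k - b.i * a.j, a.l + b.l + a.k * b.i - a.j * tri b.i,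
    a.m + b.m + (a.k - b.i * a.j) * b.j - b.i * tri a.j⟩

instance : One FreeNil where
  one := ⟨0, 0, 0, 0, 0⟩

instance : Inv FreeNil where
  inv a := ⟨-a.i, -a.j, -a.k - a.i * a.j, -a.l + a.k * a.i + a.j * tri (-a.i),
    -a.m + (a.k + a.i * a.j) * a.j - a.i * tri a.j⟩

@[simp] theorem mul_i (a b : FreeNil) : (a * b).i = a.i + b.i := rfl
@[simp] theorem mul_j (a b : FreeNil) : (a * b).j = a.j + b.j := rfl
@[simp] theorem mul_k (a b : FreeNil) : (a * b).k = a.k + b.k - b.i * a.j := rfl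
@[simp] theorem mul_l (a b : FreeNil) :
    (a * b).l = a.l + b.l + a.k * b.i - a.j * tri b.i := rfl
@[simp] theorem mul_m (a b : FreeNil) :
    (a * b).m = a.m + b.m + (a.k - b.i * a.j) * b.j - b.i * tri a.j := rfl
@[simp] theorem one_i : (1 : FreeNil).i = 0 := rfl
@[simp] theorem one_j : (1 : FreeNil).j = 0 := rfl
@[simp] theorem one_k : (1 : FreeNil).k = 0 := rfl
@[simp] theorem one_l : (1 : FreeNil).l = 0 := rfl
@[simp] theorem one_m : (1 : FreeNil).m = 0 := rfl

instance : Group FreeNil :=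
  Group.ofRightAxioms
    (by intro a b c; ext <;> simp [tri_add] <;> ring)
    (by intro a; ext <;> simp)
    (by
      intro a
      ext
      · exact add_neg_cancel _
      · exact add_neg_cancel _
      · show a.k + (-a.k - a.i * a.j) - -a.i * a.j = 0
        ring
      · show a.l + (-a.l + a.k * a.i + a.j * tri (-a.i)) + a.k * -a.i - a.j * tri (-a.i) = 0
        ring
      · show a.m + (-a.m + (a.k + a.i * a.j) * a.j - a.i * tri a.j) +
          (a.k - -a.i * a.j) * -a.j - -a.i * tri a.j = 0
        ring)

/-- The first generator. -/
def x : FreeNil := ⟨1, 0, 0, 0, 0⟩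

/-- The second generator. -/
def y : FreeNil := ⟨0, 1, 0, 0, 0⟩

theorem eq_comm_of_mul_eq {G : Type*} [Group G] {g h c : G} (e : h * g * c = g * h) :
    comm g h = c := by
  rw [comm, mul_assoc, ← e]
  group

/-- The determinant of the exponents of `x` and `y` in two elements. -/
def det (g h : FreeNil) : ℤ := g.i * h.j - g.j * h.i

/-- Commutators lie in the subgroup generated by `z`, `u`, `v`. -/
theorem exists_comm_eq (g h : FreeNil) : ∃ l m, comm g h = ⟨0, 0, det g h, l, m⟩ := by
  refine ⟨(g * h).l - (h * g).l, (g * h).m - (h * g).m, eq_comm_of_mul_eq ?_⟩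
  ext <;> simp [det] <;> ring

theorem comm_eq_of_derived (k l m : ℤ) (g : FreeNil) :
    comm (⟨0, 0, k, l, m⟩ : FreeNil) g = ⟨0, 0, 0, k * g.i, k * g.j⟩ := by
  apply eq_comm_of_mul_eq
  ext <;> simp <;> ring

theorem central_mul (l m : ℤ) (g : FreeNil) :
    (⟨0, 0, 0, l, m⟩ : FreeNil) * g = g * ⟨0, 0, 0, l, m⟩ := by
  ext <;> simp <;> ring

theorem derived_pow (k l m : ℤ) (n : ℕ) :
    (⟨0, 0, k, l, m⟩ : FreeNil) ^ n = ⟨0, 0, n * k, n * l, n * m⟩ := by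
  induction n with
  | zero => ext <;> simp
  | succ n ih => rw [pow_succ, ih]; ext <;> simp <;> ring

/-- Powers in the free nilpotent group of class 3. -/
theorem pow_eq (g : FreeNil) (n : ℕ) :
    g ^ n = ⟨n * g.i, n * g.j, n * g.k - g.i * g.j * tri n,
      n * g.l + g.k * g.i * tri n - g.i ^ 2 * g.j * n.choose 3 - g.j * tri g.i * tri n,
      n * g.m + g.k * g.j * tri n - 2 * g.i * g.j ^ 2 * n.choose 3 - g.i * g.j ^ 2 * tri n
        - g.i * tri g.j * tri n⟩ := by
  have h2 : ∀ n : ℕ, (n.choose 2 : ℤ) = tri n := by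
    intro n
    induction n with
    | zero => rfl
    | succ n ih =>
      rw [Nat.choose_succ_succ' n 1]
      push_cast
      rw [tri_add, ← ih]
      simp [add_comm]
  induction n with
  | zero => ext <;> simp
  | succ n ih =>
    have h3 : tri (n * g.j) = g.j ^ 2 * tri n + n * tri g.j := by rw [mul_comm, tri_mul]
    rw [pow_succ, ih, Nat.choose_succ_succ' n 2]
    ext <;> simp [tri_add, h2, h3] <;> ring

theorem x_zpow (n : ℤ) : x ^ n = ⟨n, 0, 0, 0, 0⟩ := by
  induction n using Int.induction_on with
  | zero => rfl
  | succ n ih => rw [zpow_add_one, ih]; ext <;> simp [x]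
  | pred n ih => rw [zpow_sub_one, ih, mul_inv_eq_iff_eq_mul]; ext <;> simp [x]

theorem y_zpow (n : ℤ) : y ^ n = ⟨0, n, 0, 0, 0⟩ := by
  induction n using Int.induction_on with
  | zero => rfl
  | succ n ih => rw [zpow_add_one, ih]; ext <;> simp [y]
  | pred n ih => rw [zpow_sub_one, ih, mul_inv_eq_iff_eq_mul]; ext <;> simp [y]

theorem derived_zpow (k l m n : ℤ) :
    (⟨0, 0, k, l, m⟩ : FreeNil) ^ n = ⟨0, 0, n * k, n * l, n * m⟩ := by
  induction n using Int.induction_on with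
  | zero => ext <;> simp
  | succ n ih => rw [zpow_add_one, ih]; ext <;> simp <;> ring
  | pred n ih => rw [zpow_sub_one, ih, mul_inv_eq_iff_eq_mul]; ext <;> simp <;> ring

theorem comm_x_y : comm x y = ⟨0, 0, 1, 0, 0⟩ := by
  apply eq_comm_of_mul_eq
  ext <;> simp [x, y]

/-- Every tuple is the product of powers of basic commutators which it stands for. -/
theorem eq_prod (g : FreeNil) :
    g = x ^ g.i * y ^ g.j * comm x y ^ g.k * comm (comm x y) x ^ g.l * comm (comm x y) y ^ g.m := by
  rw [comm_x_y, comm_eq_of_derived, comm_eq_of_derived, x_zpow, y_zpow, derived_zpow, derived_zpow,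
    derived_zpow]
  ext <;> simp [x, y]

theorem closure_x_y : Subgroup.closure {x, y} = ⊤ := by
  rw [eq_top_iff]
  intro g _
  have hx : x ∈ Subgroup.closure {x, y} := Subgroup.subset_closure (by simp)
  have hy : y ∈ Subgroup.closure {x, y} := Subgroup.subset_closure (by simp)
  have hc : ∀ a ∈ Subgroup.closure {x, y}, ∀ b ∈ Subgroup.closure {x, y},
      comm a b ∈ Subgroup.closure {x, y} := fun a ha b hb =>
    mul_mem (mul_mem (mul_mem (inv_mem ha) (inv_mem hb)) ha) hb
  have hz := hc _ hx _ hy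
  rw [eq_prod g]
  exact mul_mem (mul_mem (mul_mem (mul_mem (zpow_mem hx _) (zpow_mem hy _)) (zpow_mem hz _))
    (zpow_mem (hc _ hz _ hx) _)) (zpow_mem (hc _ hz _ hy) _)

/-! ### The universal property of the free nilpotent group -/

section Lift

variable {G : Type*} [Group G] {g h z u v : G}

theorem zpow_mul_of_mul_eq {a b c : G} (e : a * b = b * a * c) (ca : Commute a c) (s : ℤ) :
    a ^ s * b = b * (a ^ s * c ^ s) := by
  have h1 : MulAut.conj b⁻¹ a = a * c := by
    rw [MulAut.conj_apply, inv_inv, mul_assoc, e]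
    group
  have h2 : MulAut.conj b⁻¹ (a ^ s) = a ^ s * c ^ s := by
    rw [map_zpow, h1, ca.mul_zpow]
  rw [← h2, MulAut.conj_apply, inv_inv]
  group

/-- Moving a power of `h` past `g`, where `z = [g, h]` commutes with `h` up to `v`. -/
theorem zpow_mul_of_mul_eq_of_mul_eq (hz : g * h = h * g * z) (hv : z * h = h * z * v)
    (cz : Commute z v) (ch : Commute h v) (j : ℤ) :
    h ^ j * g = g * (h ^ j * (z ^ (-j) * v ^ (-tri j))) := by
  -- Passing from `j` to `j + 1` multiplies both sides by `h * z⁻¹` on the right, as `g * (h * z⁻¹) = h * g`.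
  have step : ∀ j : ℤ, g * (h ^ (j + 1) * (z ^ (-(j + 1)) * v ^ (-tri (j + 1)))) =
      g * (h ^ j * (z ^ (-j) * v ^ (-tri j))) * (h * z⁻¹) := by
    intro j
    have e1 : z ^ (-j) * h = h * (z ^ (-j) * v ^ (-j)) := zpow_mul_of_mul_eq hv cz _
    have e2 : v ^ (-tri j) * (h * z⁻¹) = h * z⁻¹ * v ^ (-tri j) :=
      ((ch.mul_left cz.inv_left).zpow_right _).eq.symm
    have e3 : v ^ (-j) * z⁻¹ = z⁻¹ * v ^ (-j) := (cz.inv_left.zpow_right _).eq.symm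
    calc g * (h ^ (j + 1) * (z ^ (-(j + 1)) * v ^ (-tri (j + 1))))
        = g * (h ^ j * (h * (z ^ (-j) * (z⁻¹ * v ^ (-j))) * v ^ (-tri j))) := by
          rw [tri_add, tri_one, mul_one, add_zero, zpow_add_one,
            show -(tri j + j) = -j + -tri j by ring, neg_add, zpow_add, zpow_add, zpow_neg_one]
          simp only [mul_assoc]
      _ = g * (h ^ j * (z ^ (-j) * h * (z⁻¹ * v ^ (-tri j)))) := by
          rw [← e3, e1]
          simp only [mul_assoc]
      _ = g * (h ^ j * (z ^ (-j) * v ^ (-tri j))) * (h * z⁻¹) := by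
          simp only [mul_assoc]
          rw [e2]
          simp only [mul_assoc]
  have comm_gh : g * (h * z⁻¹) = h * g := by
    rw [← mul_assoc, hz, mul_inv_cancel_right]
  induction j using Int.induction_on with
  | zero => simp
  | succ j ih =>
    rw [step, ← ih, mul_assoc (h ^ (j : ℤ)) g, comm_gh, zpow_add_one, mul_assoc]
  | pred j ih =>
    have h1 := step (-(j : ℤ) - 1)
    rw [sub_add_cancel, ← ih] at h1
    rw [← mul_left_inj (h * z⁻¹), ← h1, mul_assoc, comm_gh, ← mul_assoc, ← zpow_add_one,
      sub_add_cancel]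

/-- The product of powers of basic commutators in `g` and `h` for which a tuple stands. -/
def eval (g h : G) (a : FreeNil) : G :=
  g ^ a.i * (h ^ a.j * (comm g h ^ a.k * (comm (comm g h) g ^ a.l * comm (comm g h) h ^ a.m)))

theorem mul_eq_mul_comm (g h : G) : g * h = h * g * comm g h := by
  rw [comm]
  group

theorem comm_eq_one_iff_commute {g h : G} : comm g h = 1 ↔ Commute g h := by
  constructor
  · intro e
    have := mul_eq_mul_comm g h
    rwa [e, mul_one] at this
  · intro e
    have := mul_eq_mul_comm g h
    rw [e.eq] at this
    exact left_eq_mul.mp this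

theorem commute_comm {a g h : G} (hg : Commute a g) (hh : Commute a h) : Commute a (comm g h) :=
  ((hg.inv_right.mul_right hh.inv_right).mul_right hg).mul_right hh

theorem eval_mul_x (ug : Commute g (comm (comm g h) g)) (vg : Commute g (comm (comm g h) h))
    (uh : Commute h (comm (comm g h) g)) (vh : Commute h (comm (comm g h) h)) (a : FreeNil) :
    eval g h (a * x) = eval g h a * g := by
  have uz := (commute_comm ug.symm uh.symm).symm
  have vz := (commute_comm vg.symm vh.symm).symm
  have uv := commute_comm uz.symm uh.symm
  have hz := mul_eq_mul_comm g h
  have hu := mul_eq_mul_comm (comm g h) g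
  have hv := mul_eq_mul_comm (comm g h) h
  have hxi : (a * x).i = a.i + 1 := rfl
  have hxj : (a * x).j = a.j := add_zero _
  have hxk : (a * x).k = -a.j + a.k := by simp [x]; ring
  have hxl : (a * x).l = a.k + a.l := by simp [x]; ring
  have hxm : (a * x).m = -tri a.j + a.m := by simp [x]; ring
  rw [eval, eval, hxi, hxj, hxk, hxl, hxm]
  generalize comm (comm g h) g = u at *
  generalize comm (comm g h) h = v at *
  generalize comm g h = z at *
  have e1 : u ^ a.l * v ^ a.m * g = g * (u ^ a.l * v ^ a.m) :=
    ((ug.zpow_right _).mul_right (vg.zpow_right _)).eq.symm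
  have e2 := zpow_mul_of_mul_eq hu uz a.k
  have e3 := zpow_mul_of_mul_eq_of_mul_eq hz hv vz vh a.j
  have e4 : v ^ (-tri a.j) * (z ^ a.k * (u ^ a.k * u ^ a.l)) =
      z ^ a.k * (u ^ a.k * u ^ a.l) * v ^ (-tri a.j) :=
    (((vz.zpow_zpow _ _).mul_left
      (((uv.zpow_zpow _ _)).mul_left ((uv.zpow_zpow _ _)))).eq).symm
  calc g ^ (a.i + 1) * (h ^ a.j * (z ^ (-a.j + a.k) * (u ^ (a.k + a.l) * v ^ (-tri a.j + a.m))))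
      = g ^ a.i * (g * (h ^ a.j * (z ^ (-a.j) *
          (z ^ a.k * (u ^ a.k * u ^ a.l) * v ^ (-tri a.j) * v ^ a.m)))) := by
        simp only [zpow_add, zpow_one, mul_assoc]
    _ = g ^ a.i * (g * (h ^ a.j * (z ^ (-a.j) * v ^ (-tri a.j))) *
          (z ^ a.k * (u ^ a.k * (u ^ a.l * v ^ a.m)))) := by
        rw [← e4]
        simp only [mul_assoc]
    _ = g ^ a.i * (h ^ a.j * (g * (z ^ a.k * u ^ a.k) * (u ^ a.l * v ^ a.m))) := by
        rw [← e3]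
        simp only [mul_assoc]
    _ = g ^ a.i * (h ^ a.j * (z ^ a.k * (g * (u ^ a.l * v ^ a.m)))) := by
        rw [← e2]
        simp only [mul_assoc]
    _ = g ^ a.i * (h ^ a.j * (z ^ a.k * (u ^ a.l * v ^ a.m))) * g := by
        rw [← e1]
        simp only [mul_assoc]

theorem eval_mul_y (ug : Commute g (comm (comm g h) g)) (vg : Commute g (comm (comm g h) h))
    (uh : Commute h (comm (comm g h) g)) (vh : Commute h (comm (comm g h) h)) (a : FreeNil) :
    eval g h (a * y) = eval g h a * h := by
  have uz := (commute_comm ug.symm uh.symm).symm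
  have vz := (commute_comm vg.symm vh.symm).symm
  have uv := commute_comm uz.symm uh.symm
  have hv := mul_eq_mul_comm (comm g h) h
  have hxi : (a * y).i = a.i := add_zero _
  have hxj : (a * y).j = a.j + 1 := rfl
  have hxk : (a * y).k = a.k := by simp [y]
  have hxl : (a * y).l = a.l := by simp [y]
  have hxm : (a * y).m = a.k + a.m := by simp [y]; ring
  rw [eval, eval, hxi, hxj, hxk, hxl, hxm]
  generalize comm (comm g h) g = u at *
  generalize comm (comm g h) h = v at *
  generalize comm g h = z at *
  have e1 : u ^ a.l * v ^ a.m * h = h * (u ^ a.l * v ^ a.m) :=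
    ((uh.zpow_right _).mul_right (vh.zpow_right _)).eq.symm
  have e2 := zpow_mul_of_mul_eq hv vz a.k
  have e4 : v ^ a.k * u ^ a.l = u ^ a.l * v ^ a.k := (uv.zpow_zpow _ _).eq.symm
  calc g ^ a.i * (h ^ (a.j + 1) * (z ^ a.k * (u ^ a.l * v ^ (a.k + a.m))))
      = g ^ a.i * (h ^ a.j * (h * (z ^ a.k * (u ^ a.l * v ^ a.k * v ^ a.m)))) := by
        simp only [zpow_add, zpow_one, mul_assoc]
    _ = g ^ a.i * (h ^ a.j * (h * (z ^ a.k * v ^ a.k) * (u ^ a.l * v ^ a.m))) := by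
        rw [← e4]
        simp only [mul_assoc]
    _ = g ^ a.i * (h ^ a.j * (z ^ a.k * (h * (u ^ a.l * v ^ a.m)))) := by
        rw [← e2]
        simp only [mul_assoc]
    _ = g ^ a.i * (h ^ a.j * (z ^ a.k * (u ^ a.l * v ^ a.m))) * h := by
        rw [← e1]
        simp only [mul_assoc]

/-- The universal property of the free nilpotent group of class 3. -/
def lift (ug : Commute g (comm (comm g h) g)) (vg : Commute g (comm (comm g h) h))
    (uh : Commute h (comm (comm g h) g)) (vh : Commute h (comm (comm g h) h)) : FreeNil →* G :=
  MonoidHom.mk' (eval g h) (by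
    intro a b
    -- Multiplicativity in the second factor needs to be checked on the two generators only.
    have hx1 : eval g h x = g := by simp [eval, x]
    have hy1 : eval g h y = h := by simp [eval, y]
    have hb : b ∈ Subgroup.closure {x, y} := closure_x_y ▸ Subgroup.mem_top b
    induction hb using Subgroup.closure_induction generalizing a with
    | mem b hb =>
      rcases hb with rfl | rfl
      · rw [eval_mul_x ug vg uh vh, hx1]
      · rw [eval_mul_y ug vg uh vh, hy1]
    | one => simp [eval]
    | mul b c _ _ hb hc => rw [← mul_assoc, hc, hb, hc, mul_assoc]
    | inv b _ hb =>
      have h1 : ∀ a, eval g h (a * b⁻¹) = eval g h a * (eval g h b)⁻¹ := fun a => by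
        rw [eq_mul_inv_iff_mul_eq, ← hb, inv_mul_cancel_right]
      have h2 := h1 1
      rw [one_mul] at h2
      rw [h1, h2]
      simp [eval])

end Lift

end FreeNil

/-! ### The finite quotients -/

/-- Numerical data of a quotient of the free nilpotent group of class 3, in which `z` has order
`B`, `u` and `v` have order `C`, and `x ^ n = z ^ β * u ^ γ`, `y ^ n = z ^ β * v ^ γ`. The conditions
on the binomial coefficients `tri n` and `n.choose 3`, which occur in the `n`-th power of a product,
make these relations hold for all generating pairs. -/
structure Data where
  p : ℕ
  n : ℕ
  B : ℕ
  C : ℕ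
  β : ℕ
  γ : ℕ
  prime : p.Prime
  n_pos : 0 < n
  p_dvd_C : p ∣ C
  C_dvd_B : C ∣ B
  B_dvd_n : B ∣ n
  C_dvd_β : C ∣ β
  B_dvd_two_β : B ∣ 2 * β
  C_dvd_two_γ : C ∣ 2 * γ
  B_dvd_tri : (B : ℤ) ∣ tri n + β
  C_dvd_choose : C ∣ n.choose 3
  eq_two_or : p = 2 ∨ β = 0 ∧ γ = 0

namespace Data

variable (P : Data)

theorem B_pos : 0 < P.B := Nat.pos_of_dvd_of_pos P.B_dvd_n P.n_pos
theorem C_pos : 0 < P.C := Nat.pos_of_dvd_of_pos P.C_dvd_B P.B_pos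

instance : NeZero P.n := ⟨P.n_pos.ne'⟩
instance : NeZero P.B := ⟨P.B_pos.ne'⟩
instance : NeZero P.C := ⟨P.C_pos.ne'⟩
instance : Fact P.p.Prime := ⟨P.prime⟩

theorem cast_n_B : (P.n : ZMod P.B) = 0 := (ZMod.natCast_eq_zero_iff _ _).mpr P.B_dvd_n
theorem cast_n_C : (P.n : ZMod P.C) = 0 :=
  (ZMod.natCast_eq_zero_iff _ _).mpr (P.C_dvd_B.trans P.B_dvd_n)
theorem cast_n_p : (P.n : ZMod P.p) = 0 :=
  (ZMod.natCast_eq_zero_iff _ _).mpr ((P.p_dvd_C.trans P.C_dvd_B).trans P.B_dvd_n)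
theorem cast_β_C : (P.β : ZMod P.C) = 0 := (ZMod.natCast_eq_zero_iff _ _).mpr P.C_dvd_β
theorem cast_two_β : (2 * P.β : ZMod P.B) = 0 := by
  exact_mod_cast (ZMod.natCast_eq_zero_iff _ _).mpr P.B_dvd_two_β
theorem cast_two_γ : (2 * P.γ : ZMod P.C) = 0 := by
  exact_mod_cast (ZMod.natCast_eq_zero_iff _ _).mpr P.C_dvd_two_γ
theorem cast_tri_B : ((tri P.n : ℤ) : ZMod P.B) = -P.β := by
  have := (ZMod.intCast_zmod_eq_zero_iff_dvd _ _).mpr P.B_dvd_tri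
  push_cast at this
  exact eq_neg_of_add_eq_zero_left this
theorem cast_tri_C : ((tri P.n : ℤ) : ZMod P.C) = 0 := by
  rw [ZMod.intCast_zmod_eq_zero_iff_dvd]
  have h1 : (P.C : ℤ) ∣ tri P.n + P.β := dvd_trans (by exact_mod_cast P.C_dvd_B) P.B_dvd_tri
  exact (dvd_add_left (by exact_mod_cast P.C_dvd_β)).mp h1
theorem cast_choose : ((P.n.choose 3 : ℕ) : ZMod P.C) = 0 :=
  (ZMod.natCast_eq_zero_iff _ _).mpr P.C_dvd_choose

/-- Congruence of two tuples modulo the relations. Its class of `1` is generated by the elements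
`x ^ n * z ^ β * u ^ γ`, `y ^ n * z ^ β * v ^ γ`, `z ^ B`, `u ^ C` and `v ^ C`; signs are immaterial
because `2 * β` and `2 * γ` vanish modulo `B` and `C`. -/
def Rel (a b : FreeNil) : Prop :=
  ∃ s t : ℤ, b.i = a.i + P.n * s ∧ b.j = a.j + P.n * t ∧
    (b.k : ZMod P.B) = a.k + P.β * (s + t) ∧
    (b.l : ZMod P.C) = a.l + P.γ * s ∧ (b.m : ZMod P.C) = a.m + P.γ * t

variable {P}

theorem cast_tri_add_mul (i s : ℤ) : (tri (i + P.n * s) : ZMod P.C) = tri i := by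
  rw [tri_add, tri_mul]
  push_cast
  rw [cast_n_C, cast_tri_C]
  ring

theorem cast_C_eq_of_cast_B {k k' c : ℤ} (h : (k' : ZMod P.B) = k + P.β * c) :
    (k' : ZMod P.C) = k := by
  have h1 : ((k' - k - P.β * c : ℤ) : ZMod P.B) = 0 := by
    push_cast
    rw [h]
    ring
  rw [ZMod.intCast_zmod_eq_zero_iff_dvd] at h1
  have h2 := (ZMod.intCast_zmod_eq_zero_iff_dvd _ _).mpr
    (dvd_trans (Int.natCast_dvd_natCast.mpr P.C_dvd_B) h1)
  push_cast at h2
  rw [cast_β_C] at h2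
  linear_combination h2

variable (P)

/-- The congruence `Rel` is compatible with multiplication, because the terms of the product that
mix the coordinates vanish when an exponent of `x` or `y` changes by a multiple of `n`. -/
def con : Con FreeNil where
  r := P.Rel
  iseqv := by
    refine ⟨fun a => ⟨0, 0, by simp⟩, ?_, ?_⟩
    · rintro a b ⟨s, t, hi, hj, hk, hl, hm⟩
      refine ⟨-s, -t, ?_, ?_, ?_, ?_, ?_⟩
      · rw [hi]; ring
      · rw [hj]; ring
      · rw [hk]; push_cast; ring
      · rw [hl]; push_cast; ring
      · rw [hm]; push_cast; ring
    · rintro a b c ⟨s, t, hi, hj, hk, hl, hm⟩ ⟨s', t', hi', hj', hk', hl', hm'⟩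
      refine ⟨s + s', t + t', ?_, ?_, ?_, ?_, ?_⟩
      · rw [hi', hi]; ring
      · rw [hj', hj]; ring
      · rw [hk', hk]; push_cast; ring
      · rw [hl', hl]; push_cast; ring
      · rw [hm', hm]; push_cast; ring
  mul' := by
    rintro a a' b b' ⟨s, t, hi, hj, hk, hl, hm⟩ ⟨s', t', hi', hj', hk', hl', hm'⟩
    have hkC := cast_C_eq_of_cast_B (c := s + t) (by push_cast; exact hk)
    refine ⟨s + s', t + t', ?_, ?_, ?_, ?_, ?_⟩
    · simp only [FreeNil.mul_i, hi, hi']; ring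
    · simp only [FreeNil.mul_j, hj, hj']; ring
    · simp only [FreeNil.mul_k, hj, hi']
      push_cast
      rw [hk, hk', cast_n_B]
      ring
    · simp only [FreeNil.mul_l, hj, hi']
      push_cast
      rw [hl, hl', cast_tri_add_mul, hkC, cast_n_C]
      ring
    · simp only [FreeNil.mul_m, hj, hi', hj']
      push_cast
      rw [hm, hm', cast_tri_add_mul, hkC, cast_n_C]
      ring

/-- The quotient of the free nilpotent group of class 3 by the relations. -/
abbrev Quo : Type := P.con.Quotient

/-- The quotient map. -/
def proj : FreeNil →* P.Quo := P.con.mk'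

theorem proj_surjective : Function.Surjective P.proj := P.con.mk'_surjective

theorem proj_eq_proj {a b : FreeNil} : P.proj a = P.proj b ↔ P.Rel a b := P.con.eq

/-- The normal form of a tuple: the exponents of `x` and `y` are reduced modulo `n` at the expense
of those of `z`, `u` and `v`. -/
def coords (a : FreeNil) : ZMod P.n × ZMod P.n × ZMod P.B × ZMod P.C × ZMod P.C :=
  (a.i, a.j, a.k - P.β * ((a.i / P.n : ℤ) + (a.j / P.n : ℤ)), a.l - P.γ * (a.i / P.n : ℤ),
    a.m - P.γ * (a.j / P.n : ℤ))

theorem coords_eq_iff {a b : FreeNil} : P.coords a = P.coords b ↔ P.Rel a b := by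
  have hn : (P.n : ℤ) ≠ 0 := by exact_mod_cast P.n_pos.ne'
  simp only [coords, Prod.mk.injEq]
  constructor
  · rintro ⟨hi, hj, hk, hl, hm⟩
    rw [ZMod.intCast_eq_intCast_iff_dvd_sub] at hi hj
    obtain ⟨s, hs⟩ := hi
    obtain ⟨t, ht⟩ := hj
    have hi : b.i = a.i + P.n * s := by linarith
    have hj : b.j = a.j + P.n * t := by linarith
    rw [hi, hj, Int.add_mul_ediv_left _ _ hn, Int.add_mul_ediv_left _ _ hn] at hk
    rw [hi, Int.add_mul_ediv_left _ _ hn] at hl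
    rw [hj, Int.add_mul_ediv_left _ _ hn] at hm
    push_cast at hk hl hm
    exact ⟨s, t, hi, hj, by linear_combination -hk, by linear_combination -hl,
      by linear_combination -hm⟩
  · rintro ⟨s, t, hi, hj, hk, hl, hm⟩
    rw [hk, hl, hm, hi, hj, Int.add_mul_ediv_left _ _ hn, Int.add_mul_ediv_left _ _ hn]
    push_cast
    rw [CharP.cast_eq_zero]
    refine ⟨by ring, by ring, by ring, by ring, by ring⟩

theorem coords_surjective : Function.Surjective P.coords := by
  rintro ⟨i, j, k, l, m⟩
  have h : ∀ r : ZMod P.n, (r.val : ℤ) / (P.n : ℤ) = 0 := fun r =>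
    Int.ediv_eq_zero_of_lt (by positivity) (by exact_mod_cast r.val_lt)
  obtain ⟨k, rfl⟩ := ZMod.intCast_surjective k
  obtain ⟨l, rfl⟩ := ZMod.intCast_surjective l
  obtain ⟨m, rfl⟩ := ZMod.intCast_surjective m
  refine ⟨⟨i.val, j.val, k, l, m⟩, ?_⟩
  simp only [coords, h]
  simp

/-- The quotient is in bijection with its normal forms. -/
noncomputable def quoEquiv : P.Quo ≃ ZMod P.n × ZMod P.n × ZMod P.B × ZMod P.C × ZMod P.C :=
  Equiv.ofBijective (Quotient.lift P.coords fun _ _ h => P.coords_eq_iff.mpr h) (by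
    constructor
    · rintro ⟨a⟩ ⟨b⟩ h
      exact Quotient.sound (P.coords_eq_iff.mp h)
    · intro c
      obtain ⟨a, rfl⟩ := P.coords_surjective c
      exact ⟨P.proj a, rfl⟩)

instance : Finite P.Quo := Finite.of_equiv _ P.quoEquiv.symm

theorem card_quo : Nat.card P.Quo = P.n ^ 2 * P.B * P.C ^ 2 := by
  rw [Nat.card_congr P.quoEquiv]
  simp only [Nat.card_prod, Nat.card_zmod]
  ring

/-! ### The defining relations -/

/-- The defining relations, for a pair of elements of any group. -/
structure Relations {G : Type*} [Group G] (g h : G) : Prop where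
  z : comm g h ^ P.B = 1
  u : comm (comm g h) g ^ P.C = 1
  v : comm (comm g h) h ^ P.C = 1
  gu : Commute g (comm (comm g h) g)
  gv : Commute g (comm (comm g h) h)
  hu : Commute h (comm (comm g h) g)
  hv : Commute h (comm (comm g h) h)
  g_pow : g ^ P.n = comm g h ^ P.β * comm (comm g h) g ^ P.γ
  h_pow : h ^ P.n = comm g h ^ P.β * comm (comm g h) h ^ P.γ

theorem map_comm {G H : Type*} [Group G] [Group H] (f : G →* H) (a b : G) :
    f (comm a b) = comm (f a) (f b) := by
  simp [comm]

variable {P} in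
/-- The parity statement behind the relation `g ^ n = z ^ β * u ^ γ` for arbitrary generators: if
the determinant is odd, then the exponents `i`, `j` of a generator are not both even, that is,
`i + j + i * j` is odd as well. Unless `p = 2`, both `β` and `γ` vanish. -/
theorem cast_of_det {g h : FreeNil} (hd : ¬ (P.p : ℤ) ∣ FreeNil.det g h) :
    (P.β * FreeNil.det g h : ZMod P.B) = P.β * (g.i + g.j + g.i * g.j) ∧
    (P.β * FreeNil.det g h : ZMod P.B) = P.β * (h.i + h.j + h.i * h.j) ∧
    (P.γ * FreeNil.det g h : ZMod P.C) = P.γ := by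
  rcases P.eq_two_or with h2 | ⟨h0, h0'⟩
  · rw [h2] at hd
    have hodd : Odd (FreeNil.det g h) := by
      rw [← Int.not_even_iff_odd, even_iff_two_dvd]
      exact hd
    have aux : ∀ e : ℤ, Even e → (P.β * e : ZMod P.B) = 0 := by
      rintro e ⟨r, rfl⟩
      push_cast
      linear_combination (r : ZMod P.B) * P.cast_two_β
    have aux' : ∀ e : ℤ, Even e → (P.γ * e : ZMod P.C) = 0 := by
      rintro e ⟨r, rfl⟩
      push_cast
      linear_combination (r : ZMod P.C) * P.cast_two_γ
    have h1 : Even (FreeNil.det g h - (g.i + g.j + g.i * g.j)) := by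
      simp only [FreeNil.det, ← Int.not_even_iff_odd, Int.even_add, Int.even_sub,
        Int.even_mul] at hodd ⊢
      tauto
    have h3 : Even (FreeNil.det g h - (h.i + h.j + h.i * h.j)) := by
      simp only [FreeNil.det, ← Int.not_even_iff_odd, Int.even_add, Int.even_sub,
        Int.even_mul] at hodd ⊢
      tauto
    have h4 : Even (FreeNil.det g h - 1) := hodd.sub_odd odd_one
    have a1 := aux _ h1
    have a2 := aux _ h3
    have a3 := aux' _ h4
    push_cast at a1 a2 a3
    exact ⟨by linear_combination a1, by linear_combination a2, by linear_combination a3⟩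
  · simp [h0, h0']

variable {P} in
/-- The relations hold for every pair whose exponent matrix is invertible modulo `p`, and not only
for `(x, y)`. -/
theorem relations_of_det {g h : FreeNil} (hd : ¬ (P.p : ℤ) ∣ FreeNil.det g h) :
    P.Relations (P.proj g) (P.proj h) := by
  obtain ⟨c1, c2, c3⟩ := cast_of_det hd
  obtain ⟨l, m, hz⟩ := FreeNil.exists_comm_eq g h
  have hBC : (P.B : ZMod P.C) = 0 := (ZMod.natCast_eq_zero_iff _ _).mpr P.C_dvd_B
  have n1 := P.cast_n_B
  have n2 := P.cast_n_C
  have t1 := P.cast_tri_B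
  have t2 := P.cast_tri_C
  have c4 := P.cast_choose
  have b1 := P.cast_β_C
  have b2 := P.cast_two_β
  have g2 := P.cast_two_γ
  constructor
  · rw [← map_comm, ← map_pow, ← map_one P.proj, hz, FreeNil.derived_pow, proj_eq_proj]
    exact ⟨0, 0, by simp [hBC]⟩
  · rw [← map_comm, ← map_comm, ← map_pow, ← map_one P.proj, hz, FreeNil.comm_eq_of_derived,
      FreeNil.derived_pow, proj_eq_proj]
    exact ⟨0, 0, by simp⟩
  · rw [← map_comm, ← map_comm, ← map_pow, ← map_one P.proj, hz, FreeNil.comm_eq_of_derived,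
      FreeNil.derived_pow, proj_eq_proj]
    exact ⟨0, 0, by simp⟩
  · rw [← map_comm, ← map_comm, hz, FreeNil.comm_eq_of_derived]
    exact Commute.map (FreeNil.central_mul _ _ _).symm P.proj
  · rw [← map_comm, ← map_comm, hz, FreeNil.comm_eq_of_derived]
    exact Commute.map (FreeNil.central_mul _ _ _).symm P.proj
  · rw [← map_comm, ← map_comm, hz, FreeNil.comm_eq_of_derived]
    exact Commute.map (FreeNil.central_mul _ _ _).symm P.proj
  · rw [← map_comm, ← map_comm, hz, FreeNil.comm_eq_of_derived]
    exact Commute.map (FreeNil.central_mul _ _ _).symm P.proj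
  · rw [← map_comm, ← map_comm, ← map_pow, ← map_pow, ← map_pow, ← map_mul, hz,
      FreeNil.comm_eq_of_derived, FreeNil.derived_pow, FreeNil.derived_pow, FreeNil.pow_eq, eq_comm,
      proj_eq_proj]
    refine ⟨g.i, g.j, by simp, by simp, ?_, ?_, ?_⟩
    · simp only [FreeNil.mul_k]
      push_cast
      rw [n1, t1]
      linear_combination -c1 - (g.i + g.j : ZMod P.B) * b2
    · simp only [FreeNil.mul_l]
      push_cast
      rw [n2, t2, c4, b1]
      linear_combination -(g.i : ZMod P.C) * c3 - (g.i : ZMod P.C) * g2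
    · simp only [FreeNil.mul_m]
      push_cast
      rw [n2, t2, c4, b1]
      linear_combination -(g.j : ZMod P.C) * c3 - (g.j : ZMod P.C) * g2
  · rw [← map_comm, ← map_comm, ← map_pow, ← map_pow, ← map_pow, ← map_mul, hz,
      FreeNil.comm_eq_of_derived, FreeNil.derived_pow, FreeNil.derived_pow, FreeNil.pow_eq, eq_comm,
      proj_eq_proj]
    refine ⟨h.i, h.j, by simp, by simp, ?_, ?_, ?_⟩
    · simp only [FreeNil.mul_k]
      push_cast
      rw [n1, t1]
      linear_combination -c2 - (h.i + h.j : ZMod P.B) * b2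
    · simp only [FreeNil.mul_l]
      push_cast
      rw [n2, t2, c4, b1]
      linear_combination -(h.i : ZMod P.C) * c3 - (h.i : ZMod P.C) * g2
    · simp only [FreeNil.mul_m]
      push_cast
      rw [n2, t2, c4, b1]
      linear_combination -(h.j : ZMod P.C) * c3 - (h.j : ZMod P.C) * g2

section Lift

variable {P} {G : Type*} [Group G] {g h : G}

theorem zpow_eq_one_of_dvd {a : G} {N : ℕ} (ha : a ^ N = 1) {e : ℤ} (he : (N : ℤ) ∣ e) :
    a ^ e = 1 := by
  obtain ⟨r, rfl⟩ := he
  rw [zpow_mul, zpow_natCast, ha, one_zpow]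

/-- The product of basic commutators for which a tuple congruent to `1` stands is trivial whenever
the relations hold. -/
theorem Relations.eval_eq_one (r : P.Relations g h) {a : FreeNil} (ha : P.Rel 1 a) :
    FreeNil.eval g h a = 1 := by
  obtain ⟨s, t, hi, hj, hk, hl, hm⟩ := ha
  have uz := (FreeNil.commute_comm r.gu.symm r.hu.symm).symm
  have vz := (FreeNil.commute_comm r.gv.symm r.hv.symm).symm
  have uv := FreeNil.commute_comm uz.symm r.hu.symm
  have gp := r.g_pow
  have hp := r.h_pow
  have z1 := r.z
  have u1 := r.u
  have v1 := r.v
  simp only [FreeNil.one_i, FreeNil.one_j, FreeNil.one_k, FreeNil.one_l, FreeNil.one_m,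
    zero_add, Int.cast_zero] at hi hj hk hl hm
  rw [FreeNil.eval, hi, hj, zpow_mul, zpow_mul, zpow_natCast, zpow_natCast, gp, hp]
  generalize comm (comm g h) g = u at *
  generalize comm (comm g h) h = v at *
  generalize comm g h = z at *
  rw [(uz.pow_pow _ _).mul_zpow, (vz.pow_pow _ _).mul_zpow]
  simp only [← zpow_natCast, ← zpow_mul]
  have e1 : z ^ (P.β * (s + t) + a.k) = 1 := by
    refine zpow_eq_one_of_dvd z1 ?_
    rw [← ZMod.intCast_zmod_eq_zero_iff_dvd]
    push_cast
    rw [hk]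
    linear_combination (s + t : ZMod P.B) * P.cast_two_β
  have e2 : u ^ (P.γ * s + a.l) = 1 := by
    refine zpow_eq_one_of_dvd u1 ?_
    rw [← ZMod.intCast_zmod_eq_zero_iff_dvd]
    push_cast
    rw [hl]
    linear_combination (s : ZMod P.C) * P.cast_two_γ
  have e3 : v ^ (P.γ * t + a.m) = 1 := by
    refine zpow_eq_one_of_dvd v1 ?_
    rw [← ZMod.intCast_zmod_eq_zero_iff_dvd]
    push_cast
    rw [hm]
    linear_combination (t : ZMod P.C) * P.cast_two_γ
  have c1 : u ^ (P.γ * s) * z ^ (P.β * t) = z ^ (P.β * t) * u ^ (P.γ * s) :=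
    (uz.zpow_zpow _ _).eq.symm
  have c2 : u ^ (P.γ * s) * v ^ (P.γ * t) * z ^ a.k = z ^ a.k * (u ^ (P.γ * s) * v ^ (P.γ * t)) :=
    ((uz.zpow_zpow _ _).mul_right (vz.zpow_zpow _ _)).eq.symm
  have c3 : v ^ (P.γ * t) * u ^ a.l = u ^ a.l * v ^ (P.γ * t) := (uv.zpow_zpow _ _).eq.symm
  calc z ^ (P.β * s) * u ^ (P.γ * s) *
        (z ^ (P.β * t) * v ^ (P.γ * t) * (z ^ a.k * (u ^ a.l * v ^ a.m)))
      = z ^ (P.β * s) * (u ^ (P.γ * s) * z ^ (P.β * t)) * v ^ (P.γ * t) * z ^ a.k * u ^ a.l *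
          v ^ a.m := by
        simp only [mul_assoc]
    _ = z ^ (P.β * s) * z ^ (P.β * t) * (u ^ (P.γ * s) * v ^ (P.γ * t) * z ^ a.k) * u ^ a.l *
          v ^ a.m := by
        rw [c1]
        simp only [mul_assoc]
    _ = z ^ (P.β * s) * z ^ (P.β * t) * z ^ a.k * u ^ (P.γ * s) * (v ^ (P.γ * t) * u ^ a.l) *
          v ^ a.m := by
        rw [c2]
        simp only [mul_assoc]
    _ = z ^ (P.β * (s + t) + a.k) * u ^ (P.γ * s + a.l) * v ^ (P.γ * t + a.m) := by
        rw [c3]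
        simp only [mul_assoc, zpow_add, mul_add]
    _ = 1 := by rw [e1, e2, e3, mul_one, mul_one]

/-- The universal property of the quotient. -/
def Relations.lift (r : P.Relations g h) : P.Quo →* G :=
  P.con.lift (FreeNil.lift r.gu r.gv r.hu r.hv) fun a b hab => by
    have h1 : P.Rel 1 (a⁻¹ * b) := by
      have := P.con.mul (P.con.refl a⁻¹) hab
      rwa [inv_mul_cancel] at this
    have h2 : FreeNil.lift r.gu r.gv r.hu r.hv (a⁻¹ * b) = 1 := r.eval_eq_one h1
    rw [map_mul, map_inv, inv_mul_eq_one] at h2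
    exact h2

theorem Relations.lift_x (r : P.Relations g h) : r.lift (P.proj FreeNil.x) = g := by
  show FreeNil.eval g h FreeNil.x = g
  simp [FreeNil.eval, FreeNil.x]

theorem Relations.lift_y (r : P.Relations g h) : r.lift (P.proj FreeNil.y) = h := by
  show FreeNil.eval g h FreeNil.y = h
  simp [FreeNil.eval, FreeNil.y]

end Lift

theorem closure_proj : Subgroup.closure {P.proj FreeNil.x, P.proj FreeNil.y} = ⊤ := by
  have := congrArg (Subgroup.map P.proj) FreeNil.closure_x_y
  rw [MonoidHom.map_closure, Subgroup.map_top_of_surjective _ P.proj_surjective] at this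
  simpa [Set.image_pair] using this

theorem relations_proj : P.Relations (P.proj FreeNil.x) (P.proj FreeNil.y) := by
  refine relations_of_det ?_
  have : FreeNil.det FreeNil.x FreeNil.y = 1 := by simp [FreeNil.det, FreeNil.x, FreeNil.y]
  rw [this]
  intro hd
  exact P.prime.one_lt.ne' (by exact_mod_cast Int.eq_one_of_dvd_one (by positivity) hd)

/-! ### Generating pairs of the quotient -/

/-- The exponents of `x` and `y` modulo `p`: the quotient by the Frattini subgroup. -/
def exponents : P.Quo →* Multiplicative (ZMod P.p × ZMod P.p) :=
  P.con.lift
    (MonoidHom.mk' (fun a => Multiplicative.ofAdd ((a.i : ZMod P.p), (a.j : ZMod P.p)))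
      (fun a b => by simp [← ofAdd_add]))
    (by
      rintro a b ⟨s, t, hi, hj, -⟩
      show Multiplicative.ofAdd ((a.i : ZMod P.p), (a.j : ZMod P.p)) =
        Multiplicative.ofAdd ((b.i : ZMod P.p), (b.j : ZMod P.p))
      rw [hi, hj]
      push_cast
      rw [cast_n_p]
      simp)

theorem exponents_proj (a : FreeNil) :
    P.exponents (P.proj a) = Multiplicative.ofAdd ((a.i : ZMod P.p), (a.j : ZMod P.p)) := rfl

variable {P}

/-- If the determinant of a generating pair vanished modulo `p`, then some non-trivial linear
functional of the exponents would vanish on the pair. -/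
theorem not_dvd_det_of_closure_eq_top {a b : FreeNil}
    (hab : Subgroup.closure {P.proj a, P.proj b} = ⊤) : ¬ (P.p : ℤ) ∣ FreeNil.det a b := by
  intro hd
  have hdet : (a.i * b.j - a.j * b.i : ZMod P.p) = 0 := by
    have := (ZMod.intCast_zmod_eq_zero_iff_dvd _ _).mpr hd
    simpa [FreeNil.det] using this
  have key : ∀ r s : ZMod P.p, r * a.i + s * a.j = 0 → r * b.i + s * b.j = 0 → r = 0 ∧ s = 0 := by
    intro r s ha hb
    let f : ZMod P.p × ZMod P.p →+ ZMod P.p :=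
      (AddMonoidHom.mulLeft r).coprod (AddMonoidHom.mulLeft s)
    let F : P.Quo →* Multiplicative (ZMod P.p) := (AddMonoidHom.toMultiplicative f).comp P.exponents
    have hF : ∀ c, F (P.proj c) = Multiplicative.ofAdd (r * (c.i : ZMod P.p) + s * c.j) :=
      fun c => rfl
    have htriv : F = 1 := by
      refine MonoidHom.eq_of_eqOn_dense hab ?_
      rintro _ (rfl | rfl)
      · rw [hF, ha]; rfl
      · rw [hF, hb]; rfl
    have hx := hF FreeNil.x
    have hy := hF FreeNil.y
    rw [htriv] at hx hy
    simp only [FreeNil.x, FreeNil.y, MonoidHom.one_apply, Int.cast_one, Int.cast_zero, mul_one,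
      mul_zero, add_zero, zero_add] at hx hy
    exact ⟨(ofAdd_eq_one.mp hx.symm), (ofAdd_eq_one.mp hy.symm)⟩
  obtain ⟨h1, h2⟩ := key (-a.j) a.i (by ring) (by linear_combination hdet)
  obtain ⟨h3, h4⟩ := key (-b.j) b.i (by linear_combination -hdet) (by ring)
  rw [neg_eq_zero] at h1 h3
  exact one_ne_zero (key 1 0 (by rw [h2]; ring) (by rw [h4]; ring)).1

/-- Burnside's basis theorem for the quotient: a proper subgroup lies in a maximal one, which is
normal with abelian quotient, and there the exponents can be recovered from those of the pair. -/
theorem closure_eq_top_of_not_dvd_det (hP : IsPGroup P.p P.Quo) {a b : FreeNil}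
    (hd : ¬ (P.p : ℤ) ∣ FreeNil.det a b) : Subgroup.closure {P.proj a, P.proj b} = ⊤ := by
  rcases eq_top_or_exists_le_coatom (Subgroup.closure {P.proj a, P.proj b}) with h | ⟨M, hM, hle⟩
  · exact h
  exfalso
  have : Group.IsNilpotent P.Quo := hP.isNilpotent
  have hN : M.Normal := Subgroup.NormalizerCondition.normal_of_coatom M
    Group.normalizerCondition_of_isNilpotent hM
  set π := QuotientGroup.mk' M with hπ
  have hπs : Function.Surjective π := QuotientGroup.mk'_surjective M
  have hQ : IsPGroup P.p (P.Quo ⧸ M) := hP.to_quotient M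
  have hnt : Nontrivial (P.Quo ⧸ M) := by
    rw [QuotientGroup.nontrivial_iff]
    exact hM.1
  have hcent : Subgroup.center (P.Quo ⧸ M) = ⊤ := by
    have hlt : M < (Subgroup.center (P.Quo ⧸ M)).comap π := by
      have h1 := Subgroup.comap_lt_comap_of_surjective hπs |>.mpr hQ.bot_lt_center
      rwa [MonoidHom.comap_bot, QuotientGroup.ker_mk'] at h1
    have h2 := hM.2 _ hlt
    rw [← Subgroup.comap_top π] at h2
    exact Subgroup.comap_injective hπs h2
  have hcomm : ∀ c d : P.Quo ⧸ M, Commute c d := fun c d =>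
    (Subgroup.mem_center_iff.mp (hcent ▸ Subgroup.mem_top c) d).symm
  -- In the abelian quotient the image of an element depends only on its exponents.
  have hval : ∀ c : FreeNil, π (P.proj c) =
      π (P.proj FreeNil.x) ^ c.i * π (P.proj FreeNil.y) ^ c.j := by
    intro c
    have h1 : ∀ d e, comm (π d) (π e) = 1 := fun d e =>
      FreeNil.comm_eq_one_iff_commute.mpr (hcomm _ _)
    conv_lhs => rw [FreeNil.eq_prod c]
    have h2 : ∀ d : P.Quo ⧸ M, comm 1 d = 1 := fun d => by simp [comm]
    simp only [map_mul, map_zpow, map_comm, h1, h2, one_zpow, mul_one]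
  have hker : ∀ c, P.proj c ∈ Subgroup.closure {P.proj a, P.proj b} → π (P.proj c) = 1 := by
    intro c hc
    exact (QuotientGroup.eq_one_iff _).mpr (hle hc)
  have ha := hker a (Subgroup.subset_closure (by simp))
  have hb := hker b (Subgroup.subset_closure (by simp))
  rw [hval] at ha hb
  set X := π (P.proj FreeNil.x)
  set Y := π (P.proj FreeNil.y)
  -- Cramer's rule.
  have hX : X ^ FreeNil.det a b = 1 := by
    have h1 : (X ^ a.i * Y ^ a.j) ^ b.j * ((X ^ b.i * Y ^ b.j) ^ a.j)⁻¹ = X ^ FreeNil.det a b := by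
      rw [(hcomm _ _).mul_zpow, (hcomm _ _).mul_zpow, ← zpow_mul, ← zpow_mul, ← zpow_mul,
        ← zpow_mul, mul_comm b.j a.j, mul_inv_rev, mul_assoc, mul_inv_cancel_left, ← zpow_neg,
        ← zpow_add, FreeNil.det]
      congr 1
      ring
    rw [← h1, ha, hb]
    simp
  have hY : Y ^ FreeNil.det a b = 1 := by
    have h1 : (X ^ b.i * Y ^ b.j) ^ a.i * ((X ^ a.i * Y ^ a.j) ^ b.i)⁻¹ = Y ^ FreeNil.det a b := by
      rw [(hcomm _ _).mul_zpow, (hcomm (X ^ a.i) _).mul_zpow, ← zpow_mul, ← zpow_mul, ← zpow_mul,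
        ← zpow_mul, mul_comm b.i a.i, (hcomm (X ^ (a.i * b.i)) (Y ^ (b.j * a.i))).eq,
        mul_inv_rev, mul_assoc, ((hcomm (Y ^ (a.j * b.i))⁻¹ (X ^ (a.i * b.i))⁻¹)).eq,
        mul_inv_cancel_left, ← zpow_neg, ← zpow_add, FreeNil.det]
      congr 1
      ring
    rw [← h1, ha, hb]
    simp
  have hone : ∀ c : P.Quo ⧸ M, c ^ FreeNil.det a b = 1 → c = 1 := by
    intro c hc
    obtain ⟨k, hk⟩ := hQ c
    have hco : IsCoprime (FreeNil.det a b) ((P.p ^ k : ℕ) : ℤ) := by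
      push_cast
      exact ((Nat.prime_iff_prime_int.mp P.prime).coprime_iff_not_dvd.mpr hd).symm.pow_right
    obtain ⟨r, s, hrs⟩ := hco
    rw [← zpow_one c, ← hrs, zpow_add, mul_comm r, mul_comm s, zpow_mul, zpow_mul, hc, zpow_natCast,
      hk, one_zpow, one_zpow, mul_one]
  obtain ⟨c, hc⟩ := exists_ne (1 : P.Quo ⧸ M)
  obtain ⟨c, rfl⟩ := hπs c
  obtain ⟨c, rfl⟩ := P.proj_surjective c
  apply hc
  rw [hval, hone X hX, hone Y hY, one_zpow, one_zpow, mul_one]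

/-- A generating pair satisfies the defining relations, so it is the image of `(x, y)` under an
endomorphism; this is onto and, by finiteness, an automorphism. -/
theorem exists_mulAut {g h : P.Quo} (hgh : Subgroup.closure {g, h} = ⊤) :
    ∃ φ : MulAut P.Quo, φ (P.proj FreeNil.x) = g ∧ φ (P.proj FreeNil.y) = h := by
  obtain ⟨a, rfl⟩ := P.proj_surjective g
  obtain ⟨b, rfl⟩ := P.proj_surjective h
  have r := relations_of_det (not_dvd_det_of_closure_eq_top hgh)
  have hs : Function.Surjective r.lift := by
    rw [← MonoidHom.range_eq_top, eq_top_iff, ← hgh, Subgroup.closure_le]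
    rintro _ (rfl | rfl)
    · exact ⟨_, r.lift_x⟩
    · exact ⟨_, r.lift_y⟩
  exact ⟨MulEquiv.ofBijective r.lift (Finite.injective_iff_bijective.mp
    (Finite.injective_iff_surjective.mpr hs)), r.lift_x, r.lift_y⟩

/-! ### Counting generating pairs -/

theorem card_preimage_mul_card {A B : Type*} [Group A] [Group B] [Finite A] [Finite B]
    (f : A →* B) (hf : Function.Surjective f) (S : Set B) :
    Nat.card {a // f a ∈ S} * Nat.card B = Nat.card S * Nat.card A := by
  have key : ∀ S : Set B, Nat.card {a // f a ∈ S} = Nat.card S * Nat.card f.ker := by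
    intro S
    rw [← Nat.card_prod]
    refine Nat.card_congr (Equiv.trans (Equiv.sigmaFiberEquiv
      (fun a : {a // f a ∈ S} => (⟨f a.1, a.2⟩ : S))).symm
      (Equiv.trans (Equiv.sigmaCongrRight fun s => ?_) (Equiv.sigmaEquivProd _ _)))
    refine Equiv.trans ?_ (MonoidHom.fiberEquivKerOfSurjective hf s.1)
    exact
      { toFun := fun a => ⟨a.1.1, congrArg Subtype.val a.2⟩
        invFun := fun a => ⟨⟨a.1, by rw [show f a.1 = s.1 from a.2]; exact s.2⟩, Subtype.ext a.2⟩
        left_inv := fun a => rfl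
        right_inv := fun a => rfl }
  have h1 := key S
  have h2 := key Set.univ
  rw [Nat.card_congr (Equiv.subtypeUnivEquiv fun a => Set.mem_univ (f a)),
    Nat.card_congr (Equiv.Set.univ B)] at h2
  rw [h1, h2]
  ring

/-- The matrix of exponents modulo `p` of a pair. -/
def exponentMatrix : P.Quo × P.Quo →* Multiplicative (Matrix (Fin 2) (Fin 2) (ZMod P.p)) :=
  MonoidHom.mk' (fun q => Multiplicative.ofAdd
    !![(P.exponents q.1).toAdd.1, (P.exponents q.1).toAdd.2;
      (P.exponents q.2).toAdd.1, (P.exponents q.2).toAdd.2]) (by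
    intro q q'
    rw [← ofAdd_add]
    congr 1
    ext i j
    fin_cases i <;> fin_cases j <;> simp)

theorem exponentMatrix_surjective : Function.Surjective (exponentMatrix (P := P)) := by
  intro M
  obtain ⟨i, hi⟩ := ZMod.intCast_surjective (M.toAdd 0 0)
  obtain ⟨j, hj⟩ := ZMod.intCast_surjective (M.toAdd 0 1)
  obtain ⟨k, hk⟩ := ZMod.intCast_surjective (M.toAdd 1 0)
  obtain ⟨l, hl⟩ := ZMod.intCast_surjective (M.toAdd 1 1)
  refine ⟨(P.proj ⟨i, j, 0, 0, 0⟩, P.proj ⟨k, l, 0, 0, 0⟩), ?_⟩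
  apply Multiplicative.toAdd.injective
  ext r s
  fin_cases r <;> fin_cases s <;> simp [exponentMatrix, exponents_proj, hi, hj, hk, hl]

theorem closure_eq_top_iff_det (hP : IsPGroup P.p P.Quo) (q : P.Quo × P.Quo) :
    Subgroup.closure {q.1, q.2} = ⊤ ↔ (exponentMatrix q).toAdd.det ≠ 0 := by
  obtain ⟨g, h⟩ := q
  obtain ⟨a, rfl⟩ := P.proj_surjective g
  obtain ⟨b, rfl⟩ := P.proj_surjective h
  have h1 : (exponentMatrix (P.proj a, P.proj b)).toAdd.det = (FreeNil.det a b : ZMod P.p) := by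
    simp [exponentMatrix, exponents_proj, Matrix.det_fin_two, FreeNil.det]
  rw [h1, Ne, ZMod.intCast_zmod_eq_zero_iff_dvd]
  exact ⟨not_dvd_det_of_closure_eq_top, closure_eq_top_of_not_dvd_det hP⟩

theorem card_det_ne_zero (p : ℕ) [Fact p.Prime] :
    Nat.card {M : Matrix (Fin 2) (Fin 2) (ZMod p) // M.det ≠ 0} = (p ^ 2 - 1) * (p ^ 2 - p) := by
  have h := Matrix.card_GL_field (𝔽 := ZMod p) 2
  rw [Fin.prod_univ_two, ZMod.card] at h
  simp only [Fin.val_zero, pow_zero, Fin.val_one, pow_one] at h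
  rw [← h]
  refine (Nat.card_congr (Equiv.ofBijective
    (fun g : Matrix.GeneralLinearGroup (Fin 2) (ZMod p) =>
      (⟨g.1, ((Matrix.isUnit_iff_isUnit_det _).mp g.isUnit).ne_zero⟩ :
        {M : Matrix (Fin 2) (Fin 2) (ZMod p) // M.det ≠ 0})) ⟨?_, ?_⟩)).symm
  · intro g g' hg
    exact Units.ext (congrArg Subtype.val hg)
  · rintro ⟨M, hM⟩
    obtain ⟨g, hg⟩ := (Matrix.isUnit_iff_isUnit_det M).mpr hM.isUnit
    exact ⟨g, Subtype.ext hg⟩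

theorem card_generating_pairs {d : ℕ} (hd : 2 ≤ d) (hcard : Nat.card P.Quo = P.p ^ d) :
    Nat.card {q : P.Quo × P.Quo // Subgroup.closure {q.1, q.2} = ⊤} =
      P.p ^ (2 * d - 3) * (P.p + 1) * (P.p - 1) ^ 2 := by
  have hP : IsPGroup P.p P.Quo := IsPGroup.of_card hcard
  have h1 := card_preimage_mul_card (exponentMatrix (P := P)) exponentMatrix_surjective
    {M | M.toAdd.det ≠ 0}
  have h2 : Nat.card (Multiplicative (Matrix (Fin 2) (Fin 2) (ZMod P.p))) = P.p ^ 4 := by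
    rw [Nat.card_congr Multiplicative.toAdd, Matrix, Nat.card_fun, Nat.card_fun]
    simp [← pow_mul]
  have h3 : Nat.card ({M | M.toAdd.det ≠ 0} :
      Set (Multiplicative (Matrix (Fin 2) (Fin 2) (ZMod P.p)))) =
      (P.p ^ 2 - 1) * (P.p ^ 2 - P.p) := card_det_ne_zero P.p
  rw [h2, h3, Nat.card_prod, hcard] at h1
  rw [Nat.card_congr (Equiv.subtypeEquivRight (closure_eq_top_iff_det hP))]
  refine Nat.eq_of_mul_eq_mul_right (pow_pos P.prime.pos 4) (h1.trans ?_)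
  obtain ⟨e, rfl⟩ : ∃ e, d = e + 2 := ⟨d - 2, by omega⟩
  obtain ⟨r, hr⟩ : ∃ r, P.p = r + 1 := ⟨P.p - 1, by have := P.prime.pos; omega⟩
  rw [hr, show (r + 1) ^ 2 - 1 = r * (r + 2) by rw [Nat.sub_eq_iff_eq_add (Nat.one_le_pow _ (r + 1) r.succ_pos)]; ring,
    show (r + 1) ^ 2 - (r + 1) = r * (r + 1) by rw [Nat.sub_eq_iff_eq_add (by nlinarith)]; ring,
    Nat.add_sub_cancel, show 2 * (e + 2) - 3 = 2 * e + 1 by omega]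
  ring

/-! ### Orders and presentations -/

/-- The order of `x` is read off from the multiples `x ^ (n * s) = z ^ (β * s) * u ^ (γ * s)`. -/
theorem orderOf_proj_x {N : ℕ} (hn : P.n ∣ N)
    (hN : ∀ s : ℤ, ((P.B : ℤ) ∣ P.β * s ∧ (P.C : ℤ) ∣ P.γ * s) ↔ (N : ℤ) ∣ P.n * s) :
    orderOf (P.proj FreeNil.x) = N := by
  have key : ∀ s : ℕ, P.proj FreeNil.x ^ (P.n * s) = 1 ↔ N ∣ P.n * s := by
    intro s
    have h1 := hN s
    rw [← ZMod.intCast_zmod_eq_zero_iff_dvd, ← ZMod.intCast_zmod_eq_zero_iff_dvd] at h1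
    rw [← map_pow, ← zpow_natCast, FreeNil.x_zpow, ← map_one P.proj, eq_comm, proj_eq_proj,
      ← Int.natCast_dvd_natCast, Nat.cast_mul, ← h1]
    have hn0 : (P.n : ℤ) ≠ 0 := by exact_mod_cast P.n_pos.ne'
    constructor
    · rintro ⟨s', t', hi, hj, hk, hl, -⟩
      have hs : s' = s := by
        have : (P.n : ℤ) * s = P.n * s' := by simpa using hi
        exact (mul_left_cancel₀ hn0 this).symm
      have ht : t' = 0 := by simpa [P.n_pos.ne'] using hj
      subst hs ht
      push_cast
      exact ⟨by simpa using hk.symm, by simpa using hl.symm⟩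
    · rintro ⟨hk, hl⟩
      push_cast at hk hl
      exact ⟨s, 0, by simp, by simp, by simp [hk], by simp [hl], by simp⟩
  refine Nat.dvd_antisymm (orderOf_dvd_of_pow_eq_one ?_) ?_
  · obtain ⟨s, rfl⟩ := hn
    exact (key s).mpr dvd_rfl
  · have h1 : P.n ∣ orderOf (P.proj FreeNil.x) := by
      have h2 := pow_orderOf_eq_one (P.proj FreeNil.x)
      rw [← map_pow, ← zpow_natCast, FreeNil.x_zpow, ← map_one P.proj, eq_comm, proj_eq_proj] at h2
      obtain ⟨s, t, hi, -⟩ := h2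
      exact Int.natCast_dvd_natCast.mp ⟨s, by simpa using hi⟩
    obtain ⟨s, hs⟩ := h1
    rw [hs, ← key, ← hs]
    exact pow_orderOf_eq_one _

/-- A set of relators equivalent to the relations of `P` presents the quotient. -/
theorem nonempty_presentedGroup_mulEquiv {R : Set (FreeGroup (Fin 2))}
    (hR : ∀ (G : Type) [Group G] (g h : G),
      (∀ r ∈ R, FreeGroup.lift ![g, h] r = 1) ↔ P.Relations g h) :
    Nonempty (PresentedGroup R ≃* P.Quo) := by
  let f : PresentedGroup R →* P.Quo := PresentedGroup.toGroup ((hR _ _ _).mpr P.relations_proj)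
  have f0 : f (PresentedGroup.of 0) = P.proj FreeNil.x := PresentedGroup.toGroup.of _
  have f1 : f (PresentedGroup.of 1) = P.proj FreeNil.y := PresentedGroup.toGroup.of _
  have r : P.Relations (PresentedGroup.of 0 : PresentedGroup R) (PresentedGroup.of 1) := by
    rw [← hR]
    intro r hr
    have : FreeGroup.lift ![(PresentedGroup.of 0 : PresentedGroup R), PresentedGroup.of 1] =
        PresentedGroup.mk R := by
      apply FreeGroup.ext_hom
      intro i
      fin_cases i <;> simp <;> rfl
    rw [this]
    exact PresentedGroup.one_of_mem hr
  refine ⟨MonoidHom.toMulEquiv f r.lift ?_ ?_⟩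
  · apply PresentedGroup.ext
    intro i
    fin_cases i
    · simp [f0, r.lift_x]
    · simp [f1, r.lift_y]
  · refine MonoidHom.eq_of_eqOn_dense P.closure_proj ?_
    rintro _ (rfl | rfl)
    · simp only [MonoidHom.comp_apply, r.lift_x, f0, MonoidHom.id_apply]
    · simp only [MonoidHom.comp_apply, r.lift_y, f1, MonoidHom.id_apply]

/-- The row of the table for a presentation of the quotient. -/
theorem row {R : Set (FreeGroup (Fin 2))}
    (hR : ∀ (G : Type) [Group G] (g h : G),
      (∀ r ∈ R, FreeGroup.lift ![g, h] r = 1) ↔ P.Relations g h)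
    {a d : ℕ} (had : a < d) (h3 : 3 ≤ P.p ^ a) (hcard : P.n ^ 2 * P.B * P.C ^ 2 = P.p ^ d)
    (hn : P.n ∣ P.p ^ a)
    (hord : ∀ s : ℤ, ((P.B : ℤ) ∣ P.β * s ∧ (P.C : ℤ) ∣ P.γ * s) ↔ ((P.p ^ a : ℕ) : ℤ) ∣ P.n * s) :
    Row (PresentedGroup R) (P.p ^ d) (P.p ^ (2 * d - 3) * (P.p + 1) * (P.p - 1) ^ 2)
      (P.p ^ a, P.p ^ a, P.p ^ a) ((P.p : ℚ) ^ (d - a) * ((P.p : ℚ) ^ a - 3) / 2 + 1) := by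
  obtain ⟨e⟩ := nonempty_presentedGroup_mulEquiv hR
  have hc : Nat.card P.Quo = P.p ^ d := P.card_quo.trans hcard
  have ha : a ≠ 0 := by
    rintro rfl
    simp at h3
  exact Row.of_mulEquiv e (row_of_transitive P.closure_proj (fun g h => exists_mulAut) P.prime had h3
    hc (orderOf_proj_x hn hord) (card_generating_pairs (by omega) hc))

end Data

/-! ### The six families -/

theorem forall_mem_baseRels_iff {G : Type} [Group G] {p a b c : ℕ} {g h : G} :
    (∀ r ∈ baseRels p a b c, FreeGroup.lift ![g, h] r = 1) ↔
      g ^ p ^ a = 1 ∧ h ^ p ^ a = 1 ∧ comm g h ^ p ^ b = 1 ∧ comm (comm g h) g ^ p ^ c = 1 ∧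
        comm (comm g h) h ^ p ^ c = 1 ∧ Commute g (comm (comm g h) g) ∧
        Commute g (comm (comm g h) h) ∧ Commute h (comm (comm g h) g) ∧
        Commute h (comm (comm g h) h) := by
  simp only [baseRels, Set.mem_insert_iff, Set.mem_singleton_iff, forall_eq_or_imp, forall_eq,
    U, V, Z, X, Y, map_pow, Data.map_comm, FreeGroup.lift_apply_of, Matrix.cons_val_zero,
    Matrix.cons_val_one, FreeNil.comm_eq_one_iff_commute]

theorem dvd_tri_of_odd {n : ℕ} (hn : Odd n) : (n : ℤ) ∣ tri n := by
  obtain ⟨r, hr⟩ := hn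
  refine ⟨r, mul_left_cancel₀ two_ne_zero ?_⟩
  rw [two_mul_tri, hr]
  push_cast
  ring

theorem tri_two_pow_succ (e : ℕ) : tri ((2 ^ (e + 1) : ℕ) : ℤ) = 2 ^ e * (2 ^ (e + 1) - 1) := by
  refine mul_left_cancel₀ two_ne_zero ?_
  rw [two_mul_tri]
  push_cast
  ring

theorem dvd_three_mul_choose_three (n : ℕ) : n ∣ 3 * n.choose 3 := by
  cases n with
  | zero => simp
  | succ n => exact ⟨n.choose 2, by rw [Nat.add_one_mul_choose_eq n 2, mul_comm]⟩

theorem pow_dvd_choose_three {p : ℕ} (hp : p.Prime) (h3 : p ≠ 3) (e : ℕ) :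
    p ^ e ∣ (p ^ e).choose 3 :=
  (Nat.Coprime.pow_left e ((Nat.coprime_primes hp Nat.prime_three).mpr h3)).dvd_of_dvd_mul_left
    (dvd_three_mul_choose_three _)

theorem three_pow_dvd_choose_three (e : ℕ) : 3 ^ e ∣ (3 ^ (e + 1)).choose 3 := by
  have := dvd_three_mul_choose_three (3 ^ (e + 1))
  rw [pow_succ, mul_comm (3 ^ e)] at this
  rw [pow_succ, mul_comm (3 ^ e)]
  exact Nat.dvd_of_mul_dvd_mul_left (by norm_num) this

theorem two_pow_dvd_iff {m : ℕ} (hm : 1 ≤ m) (s : ℤ) :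
    (2 : ℤ) ^ m ∣ 2 ^ (m - 1) * s ↔ 2 ∣ s := by
  obtain ⟨m, rfl⟩ := Nat.exists_eq_add_of_le' hm
  rw [Nat.add_sub_cancel, pow_succ]
  exact mul_dvd_mul_iff_left (by positivity)

theorem Row.congr {G : Type} [Group G] {o o' r r' : ℕ} {t : ℕ × ℕ × ℕ} {q q' : ℚ}
    (h : Row G o r t q) (ho : o = o') (hr : r = r') (hq : q = q') : Row G o' r' t q' := by
  subst ho hr hq
  exact h

/-- The rows of the families without relations between powers of `x`, `y` and of `z`, `u`, `v`. -/
theorem row_G₁ {p a b c : ℕ} (hp : p.Prime) (hc : 1 ≤ c) (hcb : c ≤ b) (hba : b ≤ a)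
    (h3 : 3 ≤ p ^ a) (htri : ((p ^ b : ℕ) : ℤ) ∣ tri ((p ^ a : ℕ) : ℤ))
    (hchoose : p ^ c ∣ (p ^ a).choose 3) :
    Row (G₁ p a b c) (p ^ (2 * (a + c) + b))
      (p ^ (4 * a + 2 * b + 4 * c - 3) * (p + 1) * (p - 1) ^ 2) (p ^ a, p ^ a, p ^ a)
      ((p : ℚ) ^ (a + b + 2 * c) * ((p : ℚ) ^ a - 3) / 2 + 1) := by
  let P : Data :=
    { p := p, n := p ^ a, B := p ^ b, C := p ^ c, β := 0, γ := 0
      prime := hp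
      n_pos := pow_pos hp.pos a
      p_dvd_C := dvd_pow_self p (by omega)
      C_dvd_B := pow_dvd_pow p hcb
      B_dvd_n := pow_dvd_pow p hba
      C_dvd_β := dvd_zero _
      B_dvd_two_β := dvd_zero _
      C_dvd_two_γ := dvd_zero _
      B_dvd_tri := by simpa using htri
      C_dvd_choose := hchoose
      eq_two_or := Or.inr ⟨rfl, rfl⟩ }
  have key := P.row (R := baseRels p a b c) (a := a) (d := 2 * (a + c) + b) (by
      intro G _ g h
      rw [forall_mem_baseRels_iff]
      constructor
      · rintro ⟨h1, h2, h3, h4, h5, h6, h7, h8, h9⟩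
        exact ⟨h3, h4, h5, h6, h7, h8, h9, by simpa [P] using h1, by simpa [P] using h2⟩
      · rintro ⟨h3, h4, h5, h6, h7, h8, h9, h1, h2⟩
        exact ⟨by simpa [P] using h1, by simpa [P] using h2, h3, h4, h5, h6, h7, h8, h9⟩)
    (by omega) h3 (by show (p ^ a) ^ 2 * p ^ b * (p ^ c) ^ 2 = _; ring) dvd_rfl
    (fun s => by simp [P])
  refine key.congr rfl ?_ ?_
  · rw [show 2 * (2 * (a + c) + b) - 3 = 4 * a + 2 * b + 4 * c - 3 by omega]
  · rw [show 2 * (a + c) + b - a = a + b + 2 * c by omega]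

/-- The rows of the families with `p = 2` and `x ^ 2 ^ (a - 1) = z ^ β * u ^ γ`,
`y ^ 2 ^ (a - 1) = z ^ β * v ^ γ`. -/
theorem row_of_two {a b c β γ : ℕ} (hc : 1 ≤ c) (hcb : c ≤ b) (hba : b + 1 ≤ a)
    (hCβ : 2 ^ c ∣ β) (hBβ : 2 ^ b ∣ 2 * β) (hCγ : 2 ^ c ∣ 2 * γ)
    (htri : ((2 ^ b : ℕ) : ℤ) ∣ tri ((2 ^ (a - 1) : ℕ) : ℤ) + β)
    (hord : ∀ s : ℤ, ((2 : ℤ) ^ b ∣ β * s ∧ (2 : ℤ) ^ c ∣ γ * s) ↔ 2 ∣ s)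
    {W W' : FreeGroup (Fin 2)}
    (hW : ∀ (G : Type) [Group G] (g h : G),
      FreeGroup.lift ![g, h] W = comm g h ^ β * comm (comm g h) g ^ γ)
    (hW' : ∀ (G : Type) [Group G] (g h : G),
      FreeGroup.lift ![g, h] W' = comm g h ^ β * comm (comm g h) h ^ γ) :
    Row (PresentedGroup (baseRels 2 a b c ∪ {X ^ 2 ^ (a - 1) * W⁻¹, Y ^ 2 ^ (a - 1) * W'⁻¹}))
      (2 ^ (2 * (a + c) + b - 2)) (3 * 2 ^ (4 * a + 2 * b + 4 * c - 7)) (2 ^ a, 2 ^ a, 2 ^ a)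
      ((2 : ℚ) ^ (a + b + 2 * c - 3) * ((2 : ℚ) ^ a - 3) + 1) := by
  obtain ⟨e, rfl⟩ : ∃ e, a = e + 1 := ⟨a - 1, by omega⟩
  rw [Nat.add_sub_cancel] at *
  let P : Data :=
    { p := 2, n := 2 ^ e, B := 2 ^ b, C := 2 ^ c, β := β, γ := γ
      prime := Nat.prime_two
      n_pos := by positivity
      p_dvd_C := dvd_pow_self 2 (by omega)
      C_dvd_B := pow_dvd_pow 2 hcb
      B_dvd_n := pow_dvd_pow 2 (by omega)
      C_dvd_β := hCβ
      B_dvd_two_β := hBβ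
      C_dvd_two_γ := hCγ
      B_dvd_tri := htri
      C_dvd_choose := (pow_dvd_pow 2 (by omega)).trans
        (pow_dvd_choose_three Nat.prime_two (by norm_num) e)
      eq_two_or := Or.inl rfl }
  have key := P.row
    (R := baseRels 2 (e + 1) b c ∪ {X ^ 2 ^ e * W⁻¹, Y ^ 2 ^ e * W'⁻¹})
    (a := e + 1) (d := 2 * (e + 1 + c) + b - 2) (by
      intro G _ g h
      have hX : FreeGroup.lift ![g, h] X = g := by simp [X]
      have hY : FreeGroup.lift ![g, h] Y = h := by simp [Y]
      simp only [Set.mem_union, or_imp, forall_and, forall_mem_baseRels_iff, Set.mem_insert_iff,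
        Set.mem_singleton_iff, forall_eq, map_mul, map_inv, map_pow, mul_inv_eq_one, hW, hW', hX,
        hY]
      constructor
      · rintro ⟨⟨-, -, h3, h4, h5, h6, h7, h8, h9⟩, h1, h2⟩
        exact ⟨h3, h4, h5, h6, h7, h8, h9, h1, h2⟩
      · rintro ⟨h3, h4, h5, h6, h7, h8, h9, h1, h2⟩
        -- The right hand sides are involutions, which gives `x ^ 2 ^ a = y ^ 2 ^ a = 1`.
        have hsq : ∀ w : G, w ^ 2 ^ c = 1 → Commute (comm g h) w →
            (comm g h ^ β * w ^ γ) ^ 2 = 1 := by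
          intro w hw hcw
          obtain ⟨r, hr⟩ := hBβ
          obtain ⟨r', hr'⟩ := hCγ
          rw [(hcw.pow_pow _ _).mul_pow, ← pow_mul, ← pow_mul, mul_comm β, mul_comm γ, hr, hr',
            pow_mul, pow_mul, hw, show comm g h ^ 2 ^ b = 1 from h3, one_pow, one_pow, one_mul]
        refine ⟨⟨?_, ?_, h3, h4, h5, h6, h7, h8, h9⟩, h1, h2⟩
        · rw [pow_succ, pow_mul, show g ^ 2 ^ e = _ from h1]
          exact hsq _ h4 (FreeNil.commute_comm h6.symm h8.symm).symm
        · rw [pow_succ, pow_mul, show h ^ 2 ^ e = _ from h2]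
          exact hsq _ h5 (FreeNil.commute_comm h7.symm h9.symm).symm)
    (by omega)
    (by
      have : 2 ^ 2 ≤ 2 ^ (e + 1) := Nat.pow_le_pow_right (by norm_num) (by omega)
      show 3 ≤ 2 ^ (e + 1)
      omega)
    (by
      show (2 ^ e) ^ 2 * 2 ^ b * (2 ^ c) ^ 2 = 2 ^ _
      rw [← pow_mul, ← pow_mul, ← pow_add, ← pow_add]
      congr 1
      omega)
    (pow_dvd_pow 2 (by omega))
    (fun s => by
      have h1 := two_pow_dvd_iff (m := e + 1) (by omega) s
      show ((2 ^ b : ℕ) : ℤ) ∣ β * s ∧ ((2 ^ c : ℕ) : ℤ) ∣ γ * s ↔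
        ((2 ^ (e + 1) : ℕ) : ℤ) ∣ ((2 ^ e : ℕ) : ℤ) * s
      push_cast
      rw [hord s, ← h1, Nat.add_sub_cancel])
  refine key.congr rfl ?_ ?_
  · show 2 ^ _ * (2 + 1) * (2 - 1) ^ 2 = _
    rw [show 2 * (2 * (e + 1 + c) + b - 2) - 3 = 4 * (e + 1) + 2 * b + 4 * c - 7 by omega]
    ring
  · show ((2 : ℕ) : ℚ) ^ _ * (((2 : ℕ) : ℚ) ^ _ - 3) / 2 + 1 = _
    rw [show 2 * (e + 1 + c) + b - 2 - (e + 1) = (e + 1 + b + 2 * c - 3) + 1 by omega, pow_succ]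
    push_cast
    ring

end DessinGroup

theorem corollary5p2 :
    (∀ p a b c : ℕ, p.Prime → 3 < p → 1 ≤ c → c ≤ b → b ≤ a →
      DessinGroup.Row (DessinGroup.G₁ p a b c)
        (p ^ (2 * (a + c) + b))
        (p ^ (4 * a + 2 * b + 4 * c - 3) * (p + 1) * (p - 1) ^ 2)
        (p ^ a, p ^ a, p ^ a)
        ((p : ℚ) ^ (a + b + 2 * c) * ((p : ℚ) ^ a - 3) / 2 + 1)) ∧
    (∀ a b c : ℕ, (1 ≤ c ∧ c < b ∧ b = a) ∨ (1 ≤ c ∧ c ≤ b ∧ b + 1 ≤ a) →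
      DessinGroup.Row (DessinGroup.G₁ 3 a b c)
        (3 ^ (2 * (a + c) + b))
        (2 ^ 4 * 3 ^ (4 * a + 2 * b + 4 * c - 3))
        (3 ^ a, 3 ^ a, 3 ^ a)
        ((3 : ℚ) ^ (a + b + 2 * c + 1) * ((3 : ℚ) ^ (a - 1) - 1) / 2 + 1)) ∧
    (∀ a b c : ℕ, 1 ≤ c → c ≤ b → b + 1 ≤ a →
      DessinGroup.Row (DessinGroup.G₁ 2 a b c)
        (2 ^ (2 * (a + c) + b))
        (3 * 2 ^ (4 * a + 2 * b + 4 * c - 3))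
        (2 ^ a, 2 ^ a, 2 ^ a)
        ((2 : ℚ) ^ (a + b + 2 * c - 1) * ((2 : ℚ) ^ a - 3) + 1)) ∧
    (∀ a b c : ℕ, 1 ≤ c → c ≤ b → b + 2 ≤ a →
      DessinGroup.Row (DessinGroup.G₄ a b c)
        (2 ^ (2 * (a + c) + b - 2))
        (3 * 2 ^ (4 * a + 2 * b + 4 * c - 7))
        (2 ^ a, 2 ^ a, 2 ^ a)
        ((2 : ℚ) ^ (a + b + 2 * c - 3) * ((2 : ℚ) ^ a - 3) + 1)) ∧
    (∀ a c : ℕ, 1 ≤ c → c + 2 ≤ a →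
      DessinGroup.Row (DessinGroup.G₅ a c)
        (2 ^ (3 * a + 2 * c - 3))
        (3 * 2 ^ (6 * a + 4 * c - 9))
        (2 ^ a, 2 ^ a, 2 ^ a)
        ((2 : ℚ) ^ (2 * a + 2 * c - 4) * ((2 : ℚ) ^ a - 3) + 1)) ∧
    (∀ a c : ℕ, 1 ≤ c → c + 2 ≤ a →
      DessinGroup.Row (DessinGroup.G₆ a c)
        (2 ^ (3 * a + 2 * c - 3))
        (3 * 2 ^ (6 * a + 4 * c - 9))
        (2 ^ a, 2 ^ a, 2 ^ a)
        ((2 : ℚ) ^ (2 * a + 2 * c - 4) * ((2 : ℚ) ^ a - 3) + 1)) := by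
  have two_mul_pow : ∀ m : ℕ, 1 ≤ m → 2 * 2 ^ (m - 1) = 2 ^ m := fun m hm => by
    rw [← pow_succ', Nat.sub_add_cancel hm]
  -- In the last two families the triangular number of `n = 2 ^ (a - 1)` is `-β` modulo the order of
  -- `z`, where `β = 2 ^ (a - 2)`; it is the source of `z ^ β` in the relations.
  have tri_add_pow : ∀ a : ℕ, 2 ≤ a →
      ((2 ^ (a - 1) : ℕ) : ℤ) ∣ DessinGroup.tri ((2 ^ (a - 1) : ℕ) : ℤ) + (2 ^ (a - 2) : ℕ) := by
    intro a ha
    obtain ⟨e, rfl⟩ := Nat.exists_eq_add_of_le' ha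
    rw [show e + 2 - 1 = e + 1 by omega, Nat.add_sub_cancel, DessinGroup.tri_two_pow_succ]
    exact ⟨2 ^ e, by push_cast; ring⟩
  refine ⟨?_, ?_, ?_, ?_, ?_, ?_⟩
  · intro p a b c hp h3 hc hcb hba
    refine DessinGroup.row_G₁ hp hc hcb hba ?_ ?_ ?_
    · exact h3.le.trans (Nat.le_self_pow (by omega) p)
    · exact (Int.natCast_dvd_natCast.mpr (pow_dvd_pow p hba)).trans
        (DessinGroup.dvd_tri_of_odd ((hp.odd_of_ne_two (by omega)).pow))
    · exact (pow_dvd_pow p (hcb.trans hba)).trans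
        (DessinGroup.pow_dvd_choose_three hp (by omega) a)
  · intro a b c h
    obtain ⟨e, rfl⟩ : ∃ e, a = e + 1 := ⟨a - 1, by omega⟩
    refine (DessinGroup.row_G₁ (a := e + 1) (b := b) (c := c) Nat.prime_three (by omega) (by omega)
      (by omega) (Nat.le_self_pow (by omega) 3) ?_ ?_).congr rfl ?_ ?_
    · exact (Int.natCast_dvd_natCast.mpr (pow_dvd_pow 3 (by omega))).trans
        (DessinGroup.dvd_tri_of_odd ((by decide : Odd 3).pow))
    · exact (pow_dvd_pow 3 (by omega)).trans (DessinGroup.three_pow_dvd_choose_three e)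
    · norm_num
      ring
    · rw [Nat.add_sub_cancel]
      push_cast
      ring
  · intro a b c hc hcb hba
    obtain ⟨e, rfl⟩ : ∃ e, a = e + 1 := ⟨a - 1, by omega⟩
    refine (DessinGroup.row_G₁ (a := e + 1) (b := b) (c := c) Nat.prime_two hc hcb (by omega) ?_ ?_
      ?_).congr rfl ?_ ?_
    · have : 2 ^ 2 ≤ 2 ^ (e + 1) := Nat.pow_le_pow_right (by norm_num) (by omega)
      omega
    · rw [DessinGroup.tri_two_pow_succ]
      refine Dvd.dvd.mul_right ?_ _
      push_cast
      exact pow_dvd_pow 2 (by omega)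
    · exact (pow_dvd_pow 2 (by omega)).trans
        (DessinGroup.pow_dvd_choose_three Nat.prime_two (by norm_num) (e + 1))
    · norm_num
      ring
    · rw [show e + 1 + b + 2 * c = (e + 1 + b + 2 * c - 1) + 1 by omega, pow_succ,
        Nat.add_sub_cancel]
      push_cast
      ring
  · intro a b c hc hcb hba
    refine DessinGroup.row_of_two (β := 0) (γ := 2 ^ (c - 1)) hc hcb (by omega) (dvd_zero _)
      (dvd_zero _) (by rw [two_mul_pow c hc]) ?_ ?_ ?_ ?_
    · obtain ⟨e, rfl⟩ := Nat.exists_eq_add_of_le' hba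
      rw [show e + (b + 2) - 1 = e + b + 1 by omega, DessinGroup.tri_two_pow_succ]
      push_cast
      rw [add_zero]
      exact Dvd.dvd.mul_right (pow_dvd_pow 2 (by omega)) _
    · intro s
      push_cast
      rw [DessinGroup.two_pow_dvd_iff hc]
      simp
    · intro G _ g h
      simp [DessinGroup.U, DessinGroup.Z, DessinGroup.X, DessinGroup.Y, DessinGroup.Data.map_comm]
    · intro G _ g h
      simp [DessinGroup.V, DessinGroup.Z, DessinGroup.X, DessinGroup.Y, DessinGroup.Data.map_comm]
  · intro a c hc hca
    refine (DessinGroup.row_of_two (a := a) (b := a - 1) (c := c) (β := 2 ^ (a - 2)) (γ := 0) hc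
      (by omega) (by omega) (pow_dvd_pow 2 (by omega)) ?_ (dvd_zero _) (tri_add_pow a (by omega))
      ?_ ?_ ?_).congr ?_ ?_ ?_
    · rw [show a - 2 = a - 1 - 1 by omega, two_mul_pow _ (by omega)]
    · intro s
      push_cast
      rw [show a - 2 = a - 1 - 1 by omega, DessinGroup.two_pow_dvd_iff (by omega)]
      simp
    · intro G _ g h
      simp [DessinGroup.Z, DessinGroup.X, DessinGroup.Y, DessinGroup.Data.map_comm]
    · intro G _ g h
      simp [DessinGroup.Z, DessinGroup.X, DessinGroup.Y, DessinGroup.Data.map_comm]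
    · congr 1
      omega
    · congr 2
      omega
    · congr 3
      omega
  · intro a c hc hca
    refine (DessinGroup.row_of_two (a := a) (b := a - 1) (c := c) (β := 2 ^ (a - 2))
      (γ := 2 ^ (c - 1)) hc (by omega) (by omega) (pow_dvd_pow 2 (by omega)) ?_
      (by rw [two_mul_pow c hc]) (tri_add_pow a (by omega)) ?_ ?_ ?_).congr ?_ ?_ ?_
    · rw [show a - 2 = a - 1 - 1 by omega, two_mul_pow _ (by omega)]
    · intro s
      push_cast
      rw [show a - 2 = a - 1 - 1 by omega, DessinGroup.two_pow_dvd_iff (by omega),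
        DessinGroup.two_pow_dvd_iff hc, and_self]
    · intro G _ g h
      simp [DessinGroup.U, DessinGroup.Z, DessinGroup.X, DessinGroup.Y, DessinGroup.Data.map_comm]
    · intro G _ g h
      simp [DessinGroup.V, DessinGroup.Z, DessinGroup.X, DessinGroup.Y, DessinGroup.Data.map_comm]
    · congr 1
      omega
    · congr 2
      omega
    · congr 3
      omega
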